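/- Let $\Sigma$ be a finite alphabet, let $\overline\Sigma=\{\overline a : a\in\Sigma\}$ be a disjoint copy of it, and for a finite set $P$ of strings over $\Sigma$ put $f(P)=P\cup\overline P$, where $\overline P=\{\overline w : w\in P\}$ and $\overline{a_1\cdots a_k}=\overline{a_1}\cdots\overline{a_k}$. A linear superstring of $P$ is a string that has every string of $P$ as a substring; a circular superstring of $P$ is a circular string $\langle w\rangle$ such that every string of $P$ is a substring of $www\cdots$. In SLS (resp. SCS) the solutions for $P$ are the linear (resp. circular) superstrings $y$ of $P$; under the length measure the cost $|y|$ is minimized, under the compression measure the cost $\|P\|-|y|$, where $\|P\|=\sum_{w\in P}|w|$, is maximized. Let $ov(x,y)$ be the length of the longest string that is a proper suffix of $x$ and a proper prefix of $y$ (and $0$ if there is none), and let the merge of $x$ and $y$ be $x$ followed by $y$ without its first $ov(x,y)$ letters. A greedy linear superstring of $P$ is a string that results from $P$ by repeatedly replacing two different strings $u,v$ of the current set with $ov(u,v)$ maximal by their merge, ties being broken arbitrarily, until one string is left. A greedy circular superstring of $P$ is obtained from a greedy linear superstring $w$ of $P$ by merging $w$ with itself, i.e. it is the circular string formed by $w$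 without its first $ov(w,w)$ letters. For a solution of cost $c$ of an instance with optimal cost $o$ let the performance ratio be $R=\max(o/c,\,c/o)$ if $o,c>0$; otherwise let $R=1$ if $c=o$ and $R=\infty$ if $c\neq o$. **Theorem.** There is a function $g$ from circular strings over $\Sigma\cup\overline\Sigma$ to strings over $\Sigma$ such that $f$ and $g$ are computable in polynomial time and, for both the length and the compression measure, $(f,g)$ is a Strict-reduction from SLS to SCS: for every finite set $P$ of strings over $\Sigma$ and every circular superstring $c$ of $P\cup\overline P$, $g(c)$ is a linear superstring of $P$, and the performance ratio of $g(c)$ for $P$ is at most that of $c$ for $P\cup\overline P$. Moreover $|g(c)|\le |c|/2$, and a shortest circular superstring of $P\cup\overline P$ has exactly twice the length of a shortest linear superstring of $P$. On the instances $P$ in which no string is a substring of another string of $P$ (which makes $P\cup\overline P$ an instance of the same kind), $(f,g)$ is a Greedy-reduction for both measures: in addition, if $c$ is a greedy circular superstring of $P\cup\overline P$, then $g(c)$ is a greedy linear superstring of $P$. -/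

import Mathlib

open scoped ENNReal

namespace CircularSuperstring

/-! ## Strings, overlaps, merges -/

/-- `s` is an overlap from `x` to `y`: a proper suffix of `x` that is also a proper prefix
of `y`. -/
def IsOverlap {β : Type} (s x y : List β) : Prop :=
  s <:+ x ∧ s ≠ x ∧ s <+: y ∧ s ≠ y

/-- The length of the longest overlap from `x` to `y` (a supremum of a bounded set of natural
numbers; it is `0` if the only overlap is the empty one, or if there is none at all because
`x` or `y` is empty). -/
noncomputable def ov {β : Type} (x y : List β) : ℕ :=
  sSup {n | ∃ s, IsOverlap s x y ∧ s.length = n}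

/-- The merge from `x` to `y`: `x` followed by `y` without its first `ov x y` letters. -/
noncomputable def merge {β : Type} (x y : List β) : List β :=
  x ++ y.drop (ov x y)

/-- `x` is a substring of the circular string `c = ⟨w⟩`: a finite substring of the infinite
repetition `www…` (equivalently, of some finite power of `w`). -/
def IsCircularSubstring {β : Type} (x : List β) (c : Cycle β) : Prop :=
  ∃ w : List β, (w : Cycle β) = c ∧ ∃ n : ℕ, x <:+: (List.replicate n w).flatten

/-- `w` is a linear superstring of `P`. -/
def IsLinearSuperstring {β : Type} (P : Finset (List β)) (w : List β) : Prop :=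
  ∀ x ∈ P, x <:+: w

/-- `c` is a circular superstring of `P`. -/
def IsCircularSuperstring {β : Type} (P : Finset (List β)) (c : Cycle β) : Prop :=
  ∀ x ∈ P, IsCircularSubstring x c

/-- No string of `P` is a substring of another string of `P`. -/
def SubstringFree {β : Type} (P : Finset (List β)) : Prop :=
  ∀ x ∈ P, ∀ y ∈ P, x <:+: y → x = y

/-- The sum `‖P‖` of the lengths of the strings of `P`. -/
def totalLength {β : Type} (P : Finset (List β)) : ℕ :=
  ∑ w ∈ P, w.length

/-! ## The greedy algorithms -/

/-- One step of the greedy algorithm: two different strings `u`, `v` of the current set such that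
`ov u v` is maximal are removed, and their merge is inserted. -/
def GreedyStep {β : Type} [DecidableEq β] (Q Q' : Finset (List β)) : Prop :=
  ∃ u ∈ Q, ∃ v ∈ Q, u ≠ v ∧
    (∀ u' ∈ Q, ∀ v' ∈ Q, u' ≠ v' → ov u' v' ≤ ov u v) ∧
    Q' = insert (merge u v) ((Q.erase u).erase v)

/-- `w` is a greedy linear superstring of `P`: some run of the greedy algorithm (ties may be broken
in any way) that starts with `P` ends with the single string `w`. -/
def IsGreedyLinear {β : Type} [DecidableEq β] (P : Finset (List β)) (w : List β) : Prop :=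
  Relation.ReflTransGen GreedyStep P {w}

/-- `c` is a greedy circular superstring of `P`: the circular string obtained by merging a greedy
linear superstring of `P` with itself. -/
def IsGreedyCircular {β : Type} [DecidableEq β] (P : Finset (List β)) (c : Cycle β) : Prop :=
  ∃ w, IsGreedyLinear P w ∧ c = (w.drop (ov w w) : List β)

/-! ## Polynomial-time computable functions -/

/-- `h` is computable in polynomial time, when `ρ w x` (resp. `ρ' w y`) says that the word `w` is
a code of the object `x` (resp. `y`): there is a (multi-stack) Turing machine that runs in time
polynomial in the length of its input, and that turns every code of every `x` into a code of
`h x`. Objects may have several codes. -/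
def PolyTimeComputable {X Y Γ Γ' : Type} (ρ : List Γ → X → Prop) (ρ' : List Γ' → Y → Prop)
    (h : X → Y) : Prop :=
  ∃ F : {w : List Γ // ∃ x, ρ w x} → List Γ',
    Nonempty (Turing.TM2ComputableInPolyTime
      (fun w : {w : List Γ // ∃ x, ρ w x} => w.1) (fun v : List Γ' => v) F) ∧
    ∀ (w : {w : List Γ // ∃ x, ρ w x}) (x : X), ρ w.1 x → ρ' (F w) (h x)

/-- The code of a finite sequence of words; `none` marks the end of each word. -/
def encodeWords {β : Type} (l : List (List β)) : List (Option β) :=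
  l.flatMap fun w => w.map some ++ [none]

/-- A finite set of words is coded by any listing of its elements without repetition. -/
def CodesSet {β : Type} (w : List (Option β)) (P : Finset (List β)) : Prop :=
  ∃ l : List (List β), (l : Multiset (List β)) = P.val ∧ w = encodeWords l

/-- A linear string is its own code. -/
def CodesString {β : Type} (w : List β) (x : List β) : Prop :=
  w = x

/-- The circular string `⟨w⟩` is coded by `w` (and by every rotation of `w`). -/
def CodesCircular {β : Type} (w : List β) (c : Cycle β) : Prop :=
  (w : Cycle β) = c

/-! ## Optimization problems and reductions -/

/-- An optimization problem, together with the notion of greedy solution that belongs to it and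
with the coding of its instances and solutions by words. -/
structure OptimizationProblem where
  /-- the objects among which the instances are -/
  Inst : Type
  /-- the objects among which the solutions are -/
  Sol : Type
  /-- the instances -/
  IsInstance : Inst → Prop
  /-- the (feasible) solutions of an instance -/
  IsSolution : Inst → Sol → Prop
  /-- the cost of a solution -/
  cost : Inst → Sol → ℤ
  /-- whether the cost is to be maximized (otherwise it is to be minimized) -/
  maximize : Bool
  /-- the greedy solutions of an instance -/
  IsGreedy : Inst → Sol → Prop
  /-- the alphabet in which instances are written -/
  InstSymbol : Type
  /-- the alphabet in which solutions are written -/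
  SolSymbol : Type
  /-- the codes of instances -/
  codesInst : List InstSymbol → Inst → Prop
  /-- the codes of solutions -/
  codesSol : List SolSymbol → Sol → Prop

/-- `y` is an optimal solution of `x`. -/
def OptimizationProblem.IsOptimal (A : OptimizationProblem) (x : A.Inst) (y : A.Sol) : Prop :=
  A.IsSolution x y ∧ ∀ z, A.IsSolution x z →
    if A.maximize = true then A.cost x z ≤ A.cost x y else A.cost x y ≤ A.cost x z

/-- The same problem, on the instances in `S` only. -/
def OptimizationProblem.restrict (A : OptimizationProblem) (S : A.Inst → Prop) :
    OptimizationProblem :=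
  { A with IsInstance := fun x => A.IsInstance x ∧ S x }

/-- The performance ratio `max (opt / c) (c / opt)` of a solution of cost `c`, if the optimal cost
is `opt`. The quotients make sense for positive costs only; otherwise the ratio is `1` for an
optimal solution and infinite for any other one. -/
noncomputable def performanceRatio (opt c : ℤ) : ℝ≥0∞ :=
  if c = opt then 1
  else if 0 < opt ∧ 0 < c then ENNReal.ofReal (max ((opt : ℝ) / c) ((c : ℝ) / opt))
  else ⊤

/-- `(f, g)` is a Strict-reduction from `A` to `B`. -/
structure IsStrictReduction (A B : OptimizationProblem) (f : A.Inst → B.Inst)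
    (g : B.Sol → A.Sol) : Prop where
  polyTime_f : PolyTimeComputable (fun w x => A.codesInst w x ∧ A.IsInstance x) B.codesInst f
  polyTime_g : PolyTimeComputable B.codesSol A.codesSol g
  instances : ∀ x, A.IsInstance x → B.IsInstance (f x)
  solutions : ∀ x, A.IsInstance x → ∀ y, B.IsSolution (f x) y → A.IsSolution x (g y)
  ratio : ∀ x, A.IsInstance x → ∀ y, B.IsSolution (f x) y →
    ∀ optA, A.IsOptimal x optA → ∀ optB, B.IsOptimal (f x) optB →
      performanceRatio (A.cost x optA) (A.cost x (g y)) ≤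
        performanceRatio (B.cost (f x) optB) (B.cost (f x) y)

/-- `(f, g)` is a Greedy-reduction from `A` to `B`: a Strict-reduction that sends greedy solutions
to greedy solutions. -/
structure IsGreedyReduction (A B : OptimizationProblem) (f : A.Inst → B.Inst)
    (g : B.Sol → A.Sol) : Prop extends IsStrictReduction A B f g where
  greedy : ∀ x, A.IsInstance x → ∀ y, B.IsGreedy (f x) y → A.IsGreedy x (g y)

/-! ## The two superstring problems -/

/-- The two measures: the length of a superstring (to be minimized), and its compression
(to be maximized). -/
inductive Objective
  | length
  | compression

/-- The cost of a superstring of `P` of length `n`: `n` for the length measure, and `‖P‖ - n` for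
the compression measure. -/
def objectiveCost {β : Type} : Objective → Finset (List β) → ℕ → ℤ
  | .length, _, n => n
  | .compression, P, n => (totalLength P : ℤ) - n

/-- Only the compression is maximized. -/
def Objective.isMax : Objective → Bool
  | .length => false
  | .compression => true

/-- Shortest Linear Superstring over the alphabet `β`, for one of the two measures. -/
def SLS (β : Type) [DecidableEq β] (m : Objective) : OptimizationProblem where
  Inst := Finset (List β)
  Sol := List β
  IsInstance _ := True
  IsSolution := IsLinearSuperstring
  cost P w := objectiveCost m P w.length
  maximize := m.isMax
  IsGreedy := IsGreedyLinear
  InstSymbol := Option β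
  SolSymbol := β
  codesInst := CodesSet
  codesSol := CodesString

/-- Shortest Circular Superstring over the alphabet `β`, for one of the two measures. -/
def SCS (β : Type) [DecidableEq β] (m : Objective) : OptimizationProblem where
  Inst := Finset (List β)
  Sol := Cycle β
  IsInstance _ := True
  IsSolution := IsCircularSuperstring
  cost P c := objectiveCost m P c.length
  maximize := m.isMax
  IsGreedy := IsGreedyCircular
  InstSymbol := Option β
  SolSymbol := β
  codesInst := CodesSet
  codesSol := CodesCircular

/-- The set `P ∪ P̄` over the alphabet `α ⊕ α`, in which the letter `a` is `Sum.inl a`, and the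
barred letter `ā` is `Sum.inr a`. -/
def withBarred {α : Type} [DecidableEq α] (P : Finset (List α)) : Finset (List (α ⊕ α)) :=
  P.image (List.map Sum.inl) ∪ P.image (List.map Sum.inr)

end CircularSuperstring

open CircularSuperstring

/-!
Rotate a circular string over the doubled alphabet so that it starts with an unbarred and
ends with a barred letter, and let `g` return the shorter one of the word of its unbarred and the
word of its barred letters. Strings with letters of only one kind do not occur across the seam, so
that both words are linear superstrings of `P` if the circular string is a superstring of `P ∪ P̄`,
and the shorter one has at most half of its length. Conversely, `w w̄` is a circular superstring of
`P ∪ P̄` for every linear superstring `w` of `P`. Optimal lengths thus double, as does `‖P‖`, so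
that for both measures the optimal cost doubles while the cost of `c` is no better than twice the
one of `g c`. The result depends on the rotation; taking the least one for an order that compares
the patterns of bars first makes `g` a function of the circular string.

A string of `P` and one of `P̄` have no overlap. As long as two strings overlap, a greedy run on
`P ∪ P̄` hence makes greedy steps in one of the two copies, and it leads to a set `A ∪ B̄` without
overlaps, where greedy runs lead from `P` to `A` and to `B`. From there on strings are merely
concatenated, in any order. Rotating a concatenation of `A ∪ B̄` to the beginning of an unbarred run
that follows a barred one does not cut any of its strings, so that the unbarred and the barred
letters form concatenations of `A` and of `B`, which are greedy linear superstrings of `P`.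
-/

namespace CircularSuperstring

section Overlaps

variable {β γ : Type} {s u v x y : List β}

theorem bddAbove_overlapLengths (x y : List β) :
    BddAbove {n | ∃ s, IsOverlap s x y ∧ s.length = n} :=
  ⟨x.length, by rintro n ⟨s, hs, rfl⟩; exact hs.1.length_le⟩

theorem IsOverlap.length_le_ov (h : IsOverlap s x y) : s.length ≤ ov x y :=
  le_csSup (bddAbove_overlapLengths x y) ⟨s, h, rfl⟩

theorem exists_isOverlap_length_eq_ov (hx : x ≠ []) (hy : y ≠ []) :
    ∃ s, IsOverlap s x y ∧ s.length = ov x y :=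
  Nat.sSup_mem (s := {n | ∃ s, IsOverlap s x y ∧ s.length = n})
    ⟨0, [], ⟨List.nil_suffix, hx.symm, List.nil_prefix, hy.symm⟩, rfl⟩
    (bddAbove_overlapLengths x y)

theorem ov_le {k : ℕ} (h : ∀ s, IsOverlap s x y → s.length ≤ k) : ov x y ≤ k :=
  csSup_le' (by rintro n ⟨s, hs, rfl⟩; exact h s hs)

theorem isOverlap_map_iff {f : β → γ} (hf : f.Injective) {t : List γ} :
    IsOverlap t (x.map f) (y.map f) ↔ ∃ s, t = s.map f ∧ IsOverlap s x y := by
  have map_injective := List.map_injective_iff.2 hf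
  constructor
  · rintro ⟨htx, hx, hty, hy⟩
    obtain ⟨s, hsx, rfl⟩ := List.suffix_map_iff.1 htx
    obtain ⟨s', hsy, hs⟩ := List.prefix_map_iff.1 hty
    obtain rfl := map_injective hs
    exact ⟨s, rfl, hsx, mt (congrArg _) hx, hsy, mt (congrArg _) hy⟩
  · rintro ⟨s, rfl, hsx, hx, hsy, hy⟩
    exact ⟨hsx.map f, map_injective.ne hx, hsy.map f, map_injective.ne hy⟩

theorem ov_map {f : β → γ} (hf : f.Injective) (x y : List β) :
    ov (x.map f) (y.map f) = ov x y := by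
  simp only [ov, isOverlap_map_iff hf]
  congr! 3 with n
  constructor
  · rintro ⟨_, ⟨s, rfl, hs⟩, h⟩
    exact ⟨s, hs, by simpa using h⟩
  · rintro ⟨s, hs, h⟩
    exact ⟨s.map f, ⟨s, rfl, hs⟩, by simpa using h⟩

theorem merge_map {f : β → γ} (hf : f.Injective) (x y : List β) :
    merge (x.map f) (y.map f) = (merge x y).map f := by
  simp [merge, ov_map hf]

theorem merge_of_ov_eq_zero (h : ov x y = 0) : merge x y = x ++ y := by
  simp [merge, h]

theorem prefix_merge (u v : List β) : u <+: merge u v :=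
  List.prefix_append _ _

theorem exists_merge_eq_append (hu : u ≠ []) (hv : v ≠ []) :
    ∃ a s b, u = a ++ s ∧ v = s ++ b ∧ s.length = ov u v ∧ merge u v = a ++ s ++ b := by
  obtain ⟨s, ⟨⟨a, rfl⟩, -, ⟨b, rfl⟩, -⟩, hs⟩ := exists_isOverlap_length_eq_ov hu hv
  exact ⟨a, s, b, rfl, rfl, hs, by rw [merge, ← hs, List.drop_left]⟩

theorem suffix_merge (hu : u ≠ []) (hv : v ≠ []) : v <:+ merge u v := by
  obtain ⟨a, s, b, -, rfl, -, h⟩ := exists_merge_eq_append hu hv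
  exact ⟨a, by rw [h, List.append_assoc]⟩

theorem suffix_and_ne_of_not_infix {w : List β} (hs : s <:+ w) (hv : v <:+ w) (h : ¬ v <:+: s) :
    s <:+ v ∧ s ≠ v := by
  refine ⟨(List.suffix_or_suffix_of_suffix hs hv).resolve_right fun h' => h h'.isInfix, ?_⟩
  rintro rfl
  exact h List.infix_rfl

theorem prefix_and_ne_of_not_infix {w : List β} (hs : s <+: w) (hu : u <+: w) (h : ¬ u <:+: s) :
    s <+: u ∧ s ≠ u := by
  refine ⟨(List.prefix_or_prefix_of_prefix hs hu).resolve_right fun h' => h h'.isInfix, ?_⟩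
  rintro rfl
  exact h List.infix_rfl

theorem infix_append_cases {q : List β} (h : x <:+: u ++ q) :
    x <:+: u ∨ x <:+: q ∨ u <:+: x ∨ ∃ p r, x = p ++ r ∧ IsOverlap p u x ∧ r <+: q := by
  rcases List.infix_append_iff.1 h with h | h | ⟨p, r, rfl, hp, hr⟩
  · exact .inl h
  · exact .inr (.inl h)
  rcases eq_or_ne r [] with rfl | hr0
  · exact .inl (by simpa using hp.isInfix)
  rcases eq_or_ne p u with rfl | hpu
  · exact .inr (.inr (.inl (List.prefix_append _ _).isInfix))
  exact .inr (.inr (.inr ⟨p, r, rfl, ⟨hp, hpu, List.prefix_append _ _, by simpa using hr0⟩, hr⟩))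

theorem infix_of_infix_merge (hu : u ≠ []) (hv : v ≠ []) (hx : x <:+: merge u v) :
    x <:+: u ∨ x <:+: v ∨ u <:+: x ∨ ov u v < ov u x := by
  obtain ⟨a, s, b, rfl, rfl, hs, hm⟩ := exists_merge_eq_append hu hv
  rw [hm] at hx
  rcases infix_append_cases hx with h | h | h | ⟨p, r, hxp, hp, t, rfl⟩
  · exact .inl h
  · exact .inr (.inl (h.trans (List.suffix_append s b).isInfix))
  · exact .inr (.inr (.inl h))
  rcases lt_or_ge s.length p.length with hlt | hle
  · exact .inr (.inr (.inr (hs ▸ hlt.trans_le hp.length_le_ov)))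
  · obtain ⟨d, rfl⟩ := List.suffix_of_suffix_length_le hp.1 (List.suffix_append a s) hle
    exact .inr (.inl ⟨d, t, by simp [hxp]⟩)

theorem ov_merge_left_le (hu : u ≠ []) (hv : v ≠ []) (h : ¬ v <:+: y) :
    ov (merge u v) y ≤ ov v y := by
  refine ov_le fun s ⟨hs, _, hsy, hne⟩ => IsOverlap.length_le_ov ?_
  obtain ⟨hsv, hsv'⟩ :=
    suffix_and_ne_of_not_infix hs (suffix_merge hu hv) fun h' => h (h'.trans hsy.isInfix)
  exact ⟨hsv, hsv', hsy, hne⟩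

theorem ov_merge_right_le (h : ¬ u <:+: y) : ov y (merge u v) ≤ ov y u := by
  refine ov_le fun s ⟨hsy, hne, hs, _⟩ => IsOverlap.length_le_ov ?_
  obtain ⟨hsu, hsu'⟩ :=
    prefix_and_ne_of_not_infix hs (prefix_merge u v) fun h' => h (h'.trans hsy.isInfix)
  exact ⟨hsy, hne, hsu, hsu'⟩

theorem not_infix_of_prefix_merge (hu : ¬ u <:+: v) (hv : ¬ v <:+: u) (hs : s <+: merge u v)
    (hne : s ≠ merge u v) : ¬ v <:+: s := by
  intro hvs
  have hu0 : u ≠ [] := by rintro rfl; exact hu List.nil_infix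
  have hv0 : v ≠ [] := by rintro rfl; exact hv List.nil_infix
  obtain ⟨q, rfl⟩ := (List.prefix_or_prefix_of_prefix hs (prefix_merge u v)).resolve_left
    fun h => hv (hvs.trans h.isInfix)
  obtain ⟨a, o, b, rfl, rfl, ho, hm⟩ := exists_merge_eq_append hu0 hv0
  have hqb : q.length < b.length := by
    have hlt := lt_of_le_of_ne hs.length_le fun h => hne (hs.eq_of_length h)
    rw [hm] at hlt
    simpa using hlt
  rcases infix_append_cases hvs with h | h | h | ⟨p, r, hpr, hp, hrq⟩
  · exact hv h
  · have := h.length_le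
    grind
  · exact hu h
  · have := congrArg List.length hpr
    have := hp.length_le_ov
    have := hrq.length_le
    grind

theorem ov_merge_self_le (hu : ¬ u <:+: v) (hv : ¬ v <:+: u) :
    ov (merge u v) (merge u v) ≤ ov v u := by
  have hu0 : u ≠ [] := by rintro rfl; exact hu List.nil_infix
  have hv0 : v ≠ [] := by rintro rfl; exact hv List.nil_infix
  refine ov_le fun s ⟨hs, _, hs', hne⟩ => IsOverlap.length_le_ov ?_
  obtain ⟨hsv, hsv'⟩ := suffix_and_ne_of_not_infix hs (suffix_merge hu0 hv0)
    (not_infix_of_prefix_merge hu hv hs' hne)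
  obtain ⟨hsu, hsu'⟩ := prefix_and_ne_of_not_infix hs' (prefix_merge u v)
    fun h => hu (h.trans hsv.isInfix)
  exact ⟨hsv, hsv', hsu, hsu'⟩

end Overlaps

section Greedy

variable {β γ : Type} {P Q : Finset (List β)} {u v w : List β}

/-- A finite nonempty set of nonempty strings, none of which is a substring of another one: the
kind of instances that the steps of the greedy algorithm preserve. -/
structure IsProper (P : Finset (List β)) : Prop where
  substringFree : SubstringFree P
  nil_notMem : [] ∉ P
  nonempty : P.Nonempty

/-- Different strings of `P` have only the empty overlap. -/
def NonOverlapping (P : Finset (List β)) : Prop :=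
  ∀ x ∈ P, ∀ y ∈ P, x ≠ y → ov x y = 0

/-- `w` is the concatenation of the strings of `P` in some order. -/
def IsConcatenation (P : Finset (List β)) (w : List β) : Prop :=
  ∃ l : List (List β), (l : Multiset (List β)) = P.val ∧ w = l.flatten

theorem SubstringFree.not_infix (hP : SubstringFree P) (hu : u ∈ P) (hv : v ∈ P) (huv : u ≠ v) :
    ¬ u <:+: v :=
  fun h => huv (hP u hu v hv h)

theorem SubstringFree.ne_nil (hP : SubstringFree P) (hu : u ∈ P) (hv : v ∈ P) (huv : u ≠ v) :
    u ≠ [] := by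
  rintro rfl
  exact hP.not_infix hu hv huv List.nil_infix

theorem IsConcatenation.of_isRotated {a b : β} (h : IsConcatenation P w) (hr : w ~r u)
    (ha : u.head? = some a) (hb : u.getLast? = some b) (hab : ∀ t ∈ P, ¬ (a ∈ t ∧ b ∈ t)) :
    IsConcatenation P u := by
  obtain ⟨l, hl, rfl⟩ := h
  obtain ⟨n, hn, rfl⟩ := List.isRotated_iff_mod.1 hr
  rw [List.rotate_eq_drop_append_take hn] at ha hb ⊢
  rcases List.flatten_eq_append_iff.1 (List.take_append_drop n l.flatten).symm with
    ⟨l₁, l₂, rfl, h₁, h₂⟩ | ⟨l₁, x, c, y, l₂, rfl, h₁, h₂⟩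
  · refine ⟨l₂ ++ l₁, ?_, by rw [h₁, h₂, List.flatten_append]⟩
    rw [← hl]
    exact Multiset.coe_eq_coe.2 List.perm_append_comm
  rw [h₁, h₂] at ha hb ⊢
  rcases List.eq_nil_or_concat' x with rfl | ⟨x, d, rfl⟩
  · refine ⟨(c :: y) :: l₂ ++ l₁, ?_, by simp⟩
    rw [← hl]
    exact Multiset.coe_eq_coe.2 List.perm_append_comm
  · obtain rfl : c = a := by simpa using ha
    obtain rfl : d = b := by
      simpa only [← List.append_assoc, List.getLast?_concat, Option.some_inj] using hb
    have ht : x ++ [d] ++ c :: y ∈ P := by simp [← Finset.mem_val, ← hl]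
    exact absurd ⟨by simp, by simp⟩ (hab _ ht)

theorem IsConcatenation.filterMap {C : Finset (List γ)} (p : β → Option γ)
    (hC : (P.val.map (List.filterMap p)).filter (· ≠ []) = C.val) (h : IsConcatenation P w) :
    IsConcatenation C (w.filterMap p) := by
  obtain ⟨l, hl, rfl⟩ := h
  refine ⟨(l.map (List.filterMap p)).filter (· ≠ []), ?_, ?_⟩
  · rw [← hC, ← hl, Multiset.map_coe, Multiset.filter_coe]
  · rw [List.filterMap_flatten, ← List.flatten_filter_ne_nil]

variable [DecidableEq β]

theorem SubstringFree.greedyStep (hP : SubstringFree P) (h : GreedyStep P Q) :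
    SubstringFree Q := by
  obtain ⟨u, hu, v, hv, huv, hmax, rfl⟩ := h
  intro x hx y hy hxy
  simp only [Finset.mem_insert, Finset.mem_erase] at hx hy
  rcases hx with rfl | ⟨hxv, hxu, hx⟩ <;> rcases hy with rfl | ⟨-, hyu, hy⟩
  · rfl
  · exact absurd ((prefix_merge u v).isInfix.trans hxy) (hP.not_infix hu hy hyu.symm)
  · rcases infix_of_infix_merge (hP.ne_nil hu hv huv) (hP.ne_nil hv hu huv.symm) hxy
      with h | h | h | h
    · exact absurd h (hP.not_infix hx hu hxu)
    · exact absurd h (hP.not_infix hx hv hxv)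
    · exact absurd h (hP.not_infix hu hx hxu.symm)
    · exact absurd h (hmax u hu x hx hxu.symm).not_gt
  · exact hP x hx y hy hxy

theorem IsProper.greedyStep (hP : IsProper P) (h : GreedyStep P Q) : IsProper Q := by
  refine ⟨hP.substringFree.greedyStep h, ?_, ?_⟩ <;> obtain ⟨u, hu, v, -, -, -, rfl⟩ := h
  · simp only [Finset.mem_insert, Finset.mem_erase, not_or]
    refine ⟨fun hnil => ?_, fun h => hP.nil_notMem h.2.2⟩
    have hu0 : u = [] := List.prefix_nil.1 (hnil ▸ prefix_merge u v)
    exact hP.nil_notMem (hu0 ▸ hu)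
  · exact Finset.insert_nonempty _ _

theorem NonOverlapping.greedyStep (h0 : NonOverlapping P) (hP : SubstringFree P)
    (h : GreedyStep P Q) : NonOverlapping Q := by
  obtain ⟨u, hu, v, hv, huv, -, rfl⟩ := h
  intro x hx y hy hxy
  simp only [Finset.mem_insert, Finset.mem_erase] at hx hy
  rw [← Nat.le_zero]
  rcases hx with rfl | ⟨-, hxu, hx⟩ <;> rcases hy with rfl | ⟨hyv, -, hy⟩
  · exact absurd rfl hxy
  · rw [← h0 v hv y hy hyv.symm]
    exact ov_merge_left_le (hP.ne_nil hu hv huv) (hP.ne_nil hv hu huv.symm)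
      (hP.not_infix hv hy hyv.symm)
  · rw [← h0 x hx u hu hxu]
    exact ov_merge_right_le (hP.not_infix hu hx hxu.symm)
  · exact (h0 x hx y hy hxy).le

theorem SubstringFree.val_insert_append (hP : SubstringFree P) (hu : u ∈ P) (hv : v ∈ P)
    (huv : u ≠ v) :
    (insert (u ++ v) ((P.erase u).erase v)).val = (u ++ v) ::ₘ (P.val.erase u).erase v := by
  rw [Finset.insert_val_of_notMem, Finset.erase_val, Finset.erase_val]
  intro h
  have huuv := hP u hu _ (Finset.mem_of_mem_erase (Finset.mem_of_mem_erase h))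
    (List.prefix_append u v).isInfix
  exact hP.ne_nil hv hu huv.symm (List.self_eq_append_right.1 huuv)

theorem cons_cons_erase_erase_val (hu : u ∈ P) (hv : v ∈ P) (huv : u ≠ v) :
    u ::ₘ v ::ₘ (P.val.erase u).erase v = P.val := by
  rw [Multiset.cons_erase ((Multiset.mem_erase_of_ne huv.symm).2 hv), Multiset.cons_erase hu]

theorem IsConcatenation.of_insert_append (hP : SubstringFree P) (hu : u ∈ P) (hv : v ∈ P)
    (huv : u ≠ v) (h : IsConcatenation (insert (u ++ v) ((P.erase u).erase v)) w) :
    IsConcatenation P w := by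
  obtain ⟨l, hl, rfl⟩ := h
  rw [hP.val_insert_append hu hv huv] at hl
  obtain ⟨l₁, l₂, rfl⟩ := List.append_of_mem
    (Multiset.mem_coe.1 (hl ▸ Multiset.mem_cons_self (u ++ v) _))
  rw [Multiset.coe_eq_coe.2 List.perm_middle, ← Multiset.cons_coe, Multiset.cons_inj_right] at hl
  refine ⟨l₁ ++ u :: v :: l₂, ?_, by simp⟩
  rw [← cons_cons_erase_erase_val hu hv huv, ← hl]
  exact Multiset.coe_eq_coe.2 (List.perm_middle.trans (List.perm_middle.cons _))

theorem isConcatenation_of_isGreedyLinear (hP : SubstringFree P) (h0 : NonOverlapping P)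
    (h : IsGreedyLinear P w) : IsConcatenation P w := by
  unfold IsGreedyLinear at h
  induction h using Relation.ReflTransGen.head_induction_on with
  | refl => exact ⟨[w], rfl, by simp⟩
  | head hstep _ ih =>
    have hcat := ih (hP.greedyStep hstep) (h0.greedyStep hP hstep)
    obtain ⟨u, hu, v, hv, huv, -, rfl⟩ := hstep
    rw [merge_of_ov_eq_zero (h0 u hu v hv huv)] at hcat
    exact hcat.of_insert_append hP hu hv huv

theorem isGreedyLinear_flatten {P : Finset (List β)} {l : List (List β)}
    (hP : SubstringFree P) (h0 : NonOverlapping P) (hl : (l : Multiset (List β)) = P.val)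
    (hne : l ≠ []) : IsGreedyLinear P l.flatten := by
  match l, hne with
  | [x], _ =>
    obtain rfl : P = {x} := Finset.val_injective (by rw [← hl]; rfl)
    rw [List.flatten_singleton]
    exact Relation.ReflTransGen.refl
  | u :: v :: r, _ =>
    have hu : u ∈ P := by simp [← Finset.mem_val, ← hl]
    have hv : v ∈ P := by simp [← Finset.mem_val, ← hl]
    have huv : u ≠ v := by
      have hnd : (u :: v :: r).Nodup := by simpa [← hl] using P.nodup
      rintro rfl
      simp at hnd
    have hstep : GreedyStep P (insert (u ++ v) ((P.erase u).erase v)) :=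
      ⟨u, hu, v, hv, huv, fun x hx y hy hxy => (h0 x hx y hy hxy).trans_le (Nat.zero_le _),
        by rw [merge_of_ov_eq_zero (h0 u hu v hv huv)]⟩
    have hval : (((u ++ v) :: r : List (List β)) : Multiset (List β)) =
        (insert (u ++ v) ((P.erase u).erase v)).val := by
      simp [hP.val_insert_append hu hv huv, ← hl]
    have ih := isGreedyLinear_flatten (hP.greedyStep hstep) (h0.greedyStep hP hstep) hval
      (List.cons_ne_nil _ _)
    rw [List.flatten_cons, List.append_assoc] at ih
    exact Relation.ReflTransGen.head hstep ih
termination_by l.length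

theorem IsConcatenation.isGreedyLinear (h : IsConcatenation P w) (hP : SubstringFree P)
    (h0 : NonOverlapping P) (hne : P.Nonempty) : IsGreedyLinear P w := by
  obtain ⟨l, hl, rfl⟩ := h
  refine isGreedyLinear_flatten hP h0 hl ?_
  rintro rfl
  exact hne.ne_empty (Finset.val_injective hl.symm)

theorem ov_self_eq_zero_of_isGreedyLinear (hP : SubstringFree P) (h0 : NonOverlapping P)
    (h : IsGreedyLinear P w) (hne : P ≠ {w}) : ov w w = 0 := by
  unfold IsGreedyLinear at h
  induction h using Relation.ReflTransGen.head_induction_on with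
  | refl => exact absurd rfl hne
  | @head P Q hstep _ ih =>
    by_cases hQ : Q = {w}
    · obtain ⟨u, hu, v, hv, huv, -, rfl⟩ := hstep
      obtain rfl : merge u v = w := Finset.mem_singleton.1 (hQ ▸ Finset.mem_insert_self _ _)
      exact Nat.le_zero.1 ((ov_merge_self_le (hP.not_infix hu hv huv)
        (hP.not_infix hv hu huv.symm)).trans_eq (h0 v hv u hu huv.symm))
    · exact ih (hP.greedyStep hstep) (h0.greedyStep hP hstep) hQ

theorem GreedyStep.exists_of_image [DecidableEq γ] {f : β → γ} (hf : f.Injective)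
    {Q : Finset (List γ)} (h : GreedyStep (P.image (List.map f)) Q) :
    ∃ P', GreedyStep P P' ∧ Q = P'.image (List.map f) := by
  have map_injective := List.map_injective_iff.2 hf
  obtain ⟨u', hu, v', hv, huv, hmax, rfl⟩ := h
  obtain ⟨u, huP, rfl⟩ := Finset.mem_image.1 hu
  obtain ⟨v, hvP, rfl⟩ := Finset.mem_image.1 hv
  refine ⟨_, ⟨u, huP, v, hvP, ne_of_apply_ne _ huv, fun x hx y hy hxy => ?_, rfl⟩, ?_⟩
  · have := hmax _ (Finset.mem_image_of_mem _ hx) _ (Finset.mem_image_of_mem _ hy)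
      (map_injective.ne hxy)
    rwa [ov_map hf, ov_map hf] at this
  · rw [merge_map hf, Finset.image_insert, Finset.image_erase map_injective,
      Finset.image_erase map_injective]

theorem exists_greedyStep_left_of_union {A B : Finset (List β)} (hd : Disjoint A B)
    (hu : u ∈ A) (hv : v ∈ A) (huv : u ≠ v)
    (hmax : ∀ x ∈ A ∪ B, ∀ y ∈ A ∪ B, x ≠ y → ov x y ≤ ov u v) :
    ∃ A', GreedyStep A A' ∧ insert (merge u v) (((A ∪ B).erase u).erase v) = A' ∪ B := by
  refine ⟨_, ⟨u, hu, v, hv, huv, fun x hx y hy => ?_, rfl⟩, ?_⟩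
  · exact hmax x (Finset.mem_union_left _ hx) y (Finset.mem_union_left _ hy)
  · rw [Finset.erase_union_distrib, Finset.erase_union_distrib, Finset.insert_union,
      Finset.erase_eq_of_notMem (Finset.disjoint_left.1 hd hu),
      Finset.erase_eq_of_notMem (Finset.disjoint_left.1 hd hv)]

theorem GreedyStep.exists_of_union {A B : Finset (List β)} (hd : Disjoint A B)
    (hAB : ∀ x ∈ A, ∀ y ∈ B, ov x y = 0 ∧ ov y x = 0) (hov : ¬ NonOverlapping (A ∪ B))
    (h : GreedyStep (A ∪ B) Q) :
    (∃ A', GreedyStep A A' ∧ Q = A' ∪ B) ∨ ∃ B', GreedyStep B B' ∧ Q = A ∪ B' := by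
  obtain ⟨u, hu, v, hv, huv, hmax, rfl⟩ := h
  have hpos : ov u v ≠ 0 := fun h => hov fun x hx y hy hxy =>
    Nat.le_zero.1 (h ▸ hmax x hx y hy hxy)
  rcases Finset.mem_union.1 hu with hu | hu <;> rcases Finset.mem_union.1 hv with hv | hv
  · exact .inl (exists_greedyStep_left_of_union hd hu hv huv hmax)
  · exact absurd (hAB u hu v hv).1 hpos
  · exact absurd (hAB v hv u hu).2 hpos
  · rw [Finset.union_comm A] at hmax ⊢
    obtain ⟨B', hB', h⟩ := exists_greedyStep_left_of_union hd.symm hu hv huv hmax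
    exact .inr ⟨B', hB', by rw [h, Finset.union_comm]⟩

end Greedy

section Doubled

variable {α : Type}

/-- The subword of the unbarred letters of a string over the doubled alphabet. -/
def unbarredPart (u : List (α ⊕ α)) : List α := u.filterMap Sum.getLeft?

/-- The subword of the barred letters of a string over the doubled alphabet, without the bars. -/
def barredPart (u : List (α ⊕ α)) : List α := u.filterMap Sum.getRight?

/-- The string begins with an unbarred letter and ends with a barred one, so that in `⟨u⟩` a block
of unbarred letters begins where `u` does. -/
def StartsBlock (u : List (α ⊕ α)) : Prop :=
  (∃ a, u.head? = some (.inl a)) ∧ ∃ b, u.getLast? = some (.inr b)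

theorem unbarredPart_map_inl (x : List α) : unbarredPart (x.map Sum.inl) = x := by
  simp [unbarredPart, List.filterMap_map, Function.comp_def]

theorem unbarredPart_map_inr (x : List α) : unbarredPart (x.map Sum.inr) = [] := by
  simp [unbarredPart, List.filterMap_map, Function.comp_def]

theorem barredPart_map_inl (x : List α) : barredPart (x.map Sum.inl) = [] := by
  simp [barredPart, List.filterMap_map, Function.comp_def]

theorem barredPart_map_inr (x : List α) : barredPart (x.map Sum.inr) = x := by
  simp [barredPart, List.filterMap_map, Function.comp_def]

theorem length_unbarredPart_add_length_barredPart (u : List (α ⊕ α)) :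
    (unbarredPart u).length + (barredPart u).length = u.length := by
  induction u with
  | nil => rfl
  | cons a u ih =>
    simp only [unbarredPart, barredPart] at ih ⊢
    cases a <;> simp [List.filterMap_cons] <;> omega

theorem map_inl_injective : (List.map (Sum.inl : α → α ⊕ α)).Injective :=
  List.map_injective_iff.2 Sum.inl_injective

theorem map_inr_injective : (List.map (Sum.inr : α → α ⊕ α)).Injective :=
  List.map_injective_iff.2 Sum.inr_injective

theorem infix_of_map_infix_map {β γ : Type} {f : β → γ} (hf : f.Injective) {x y : List β}
    (h : x.map f <:+: y.map f) : x <:+: y := by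
  obtain ⟨z, hz, h⟩ := List.infix_map_iff.1 h
  rwa [List.map_injective_iff.2 hf h]

theorem disjoint_map_inl_map_inr (x y : List α) :
    (x.map (Sum.inl : α → α ⊕ α)).Disjoint (y.map Sum.inr) := by
  simp [List.Disjoint]

theorem eq_nil_of_infix_of_disjoint {β : Type} {x y : List β} (h : x <:+: y)
    (hd : x.Disjoint y) : x = [] :=
  List.eq_nil_iff_forall_not_mem.2 fun _ ha => hd ha (h.subset ha)

theorem ov_eq_zero_of_disjoint {β : Type} {x y : List β} (hd : x.Disjoint y) : ov x y = 0 := by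
  refine Nat.le_zero.1 (ov_le fun s ⟨hsx, _, hsy, _⟩ => ?_)
  rw [eq_nil_of_infix_of_disjoint hsx.isInfix fun a ha _ => hd (hsx.subset ha) (hsy.subset ha),
    List.length_nil]

theorem SubstringFree.eq_singleton_nil {β : Type} {P : Finset (List β)} (hP : SubstringFree P)
    (h : [] ∈ P) : P = {[]} :=
  Finset.eq_singleton_iff_unique_mem.2 ⟨h, fun x hx => (hP [] h x hx List.nil_infix).symm⟩

theorem NonOverlapping.of_image {β γ : Type} [DecidableEq γ] {f : β → γ} (hf : f.Injective)
    {P : Finset (List β)} (h : NonOverlapping (P.image (List.map f))) : NonOverlapping P := by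
  intro x hx y hy hxy
  rw [← ov_map hf]
  exact h _ (Finset.mem_image_of_mem _ hx) _ (Finset.mem_image_of_mem _ hy)
    ((List.map_injective_iff.2 hf).ne hxy)

theorem NonOverlapping.mono {β : Type} {P Q : Finset (List β)} (hPQ : P ⊆ Q)
    (h : NonOverlapping Q) : NonOverlapping P :=
  fun x hx y hy => h x (hPQ hx) y (hPQ hy)

theorem IsProper.reflTransGen {β : Type} [DecidableEq β] {P Q : Finset (List β)} (hP : IsProper P)
    (h : Relation.ReflTransGen GreedyStep P Q) : IsProper Q := by
  induction h with
  | refl => exact hP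
  | tail _ hstep ih => exact ih.greedyStep hstep

variable [DecidableEq α] {A B P : Finset (List α)} {u w : List (α ⊕ α)}

/-- The set `A ∪ B̄`. A greedy run on `withBarred P = P ∪ P̄` passes through sets of this form. -/
def barredUnion (A B : Finset (List α)) : Finset (List (α ⊕ α)) :=
  A.image (List.map Sum.inl) ∪ B.image (List.map Sum.inr)

theorem mem_barredUnion {x : List (α ⊕ α)} :
    x ∈ barredUnion A B ↔ (∃ a ∈ A, a.map Sum.inl = x) ∨ ∃ b ∈ B, b.map Sum.inr = x := by
  simp [barredUnion]

theorem disjoint_image_inl_image_inr (hB : [] ∉ B) :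
    Disjoint (A.image (List.map Sum.inl)) (B.image (List.map (Sum.inr : α → α ⊕ α))) := by
  simp only [Finset.disjoint_left, Finset.mem_image, not_exists, not_and]
  rintro _ ⟨a, -, rfl⟩ b hb h
  have hnil := eq_nil_of_infix_of_disjoint (h ▸ List.infix_rfl)
    (disjoint_map_inl_map_inr a b).symm
  exact hB (List.map_eq_nil_iff.1 hnil ▸ hb)

theorem val_barredUnion (hB : [] ∉ B) :
    (barredUnion A B).val = A.val.map (List.map Sum.inl) + B.val.map (List.map Sum.inr) := by
  rw [barredUnion, ← Finset.disjUnion_eq_union _ _ (disjoint_image_inl_image_inr hB),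
    Finset.disjUnion_val, Finset.image_val_of_injOn map_inl_injective.injOn,
    Finset.image_val_of_injOn map_inr_injective.injOn]

theorem substringFree_barredUnion (hA : SubstringFree A) (hB : SubstringFree B) (hA0 : [] ∉ A)
    (hB0 : [] ∉ B) : SubstringFree (barredUnion A B) := by
  intro x hx y hy hxy
  rcases mem_barredUnion.1 hx with ⟨a, ha, rfl⟩ | ⟨a, ha, rfl⟩ <;>
    rcases mem_barredUnion.1 hy with ⟨b, hb, rfl⟩ | ⟨b, hb, rfl⟩
  · rw [hA a ha b hb (infix_of_map_infix_map Sum.inl_injective hxy)]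
  · have hnil := eq_nil_of_infix_of_disjoint hxy (disjoint_map_inl_map_inr a b)
    exact absurd (List.map_eq_nil_iff.1 hnil ▸ ha) hA0
  · have hnil := eq_nil_of_infix_of_disjoint hxy (disjoint_map_inl_map_inr b a).symm
    exact absurd (List.map_eq_nil_iff.1 hnil ▸ ha) hB0
  · rw [hB a ha b hb (infix_of_map_infix_map Sum.inr_injective hxy)]

theorem substringFree_withBarred (hP : SubstringFree P) : SubstringFree (withBarred P) := by
  by_cases hnil : [] ∈ P
  · simp [hP.eq_singleton_nil hnil, withBarred, SubstringFree]
  · exact substringFree_barredUnion hP hP hnil hnil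

theorem isConcatenation_unbarredPart (hA : [] ∉ A) (hB : [] ∉ B)
    (h : IsConcatenation (barredUnion A B) w) : IsConcatenation A (unbarredPart w) := by
  refine h.filterMap Sum.getLeft? ?_
  change ((barredUnion A B).val.map unbarredPart).filter (· ≠ []) = A.val
  simp only [val_barredUnion hB, Multiset.map_add, Multiset.map_map, Function.comp_apply,
    unbarredPart_map_inl, unbarredPart_map_inr, Multiset.map_id', Multiset.filter_add]
  rw [Multiset.filter_eq_self.2 fun x hx => ne_of_mem_of_not_mem hx hA,
    Multiset.filter_eq_nil.2 (Multiset.forall_mem_map_iff.2 (by simp)), add_zero]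

theorem isConcatenation_barredPart (hB : [] ∉ B) (h : IsConcatenation (barredUnion A B) w) :
    IsConcatenation B (barredPart w) := by
  refine h.filterMap Sum.getRight? ?_
  change ((barredUnion A B).val.map barredPart).filter (· ≠ []) = B.val
  simp only [val_barredUnion hB, Multiset.map_add, Multiset.map_map, Function.comp_apply,
    barredPart_map_inl, barredPart_map_inr, Multiset.map_id', Multiset.filter_add]
  rw [Multiset.filter_eq_self.2 fun x hx => ne_of_mem_of_not_mem hx hB,
    Multiset.filter_eq_nil.2 (Multiset.forall_mem_map_iff.2 (by simp)), zero_add]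

theorem IsConcatenation.of_isRotated_of_startsBlock (h : IsConcatenation (barredUnion A B) w)
    (hr : w ~r u) (hu : StartsBlock u) : IsConcatenation (barredUnion A B) u := by
  obtain ⟨⟨a, ha⟩, b, hb⟩ := hu
  refine h.of_isRotated hr ha hb fun t ht => ?_
  rcases mem_barredUnion.1 ht with ⟨x, -, rfl⟩ | ⟨x, -, rfl⟩ <;> simp

theorem exists_nonOverlapping_of_isGreedyLinear (hA : IsProper A) (hB : IsProper B)
    (h : IsGreedyLinear (barredUnion A B) w) :
    ∃ A' B', Relation.ReflTransGen GreedyStep A A' ∧ Relation.ReflTransGen GreedyStep B B' ∧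
      NonOverlapping (barredUnion A' B') ∧ IsGreedyLinear (barredUnion A' B') w := by
  unfold IsGreedyLinear at h
  generalize hQ : barredUnion A B = Q at h
  induction h using Relation.ReflTransGen.head_induction_on generalizing A B with
  | refl =>
    refine ⟨A, B, .refl, .refl, ?_, hQ ▸ .refl⟩
    rw [hQ]
    intro x hx y hy hxy
    exact absurd ((Finset.mem_singleton.1 hx).trans (Finset.mem_singleton.1 hy).symm) hxy
  | head hstep htail ih =>
    subst hQ
    by_cases hov : NonOverlapping (barredUnion A B)
    · exact ⟨A, B, .refl, .refl, hov, .head hstep htail⟩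
    have hcross : ∀ x ∈ A.image (List.map Sum.inl),
        ∀ y ∈ B.image (List.map (Sum.inr : α → α ⊕ α)), ov x y = 0 ∧ ov y x = 0 := by
      simp only [Finset.mem_image]
      rintro _ ⟨a, -, rfl⟩ _ ⟨b, -, rfl⟩
      exact ⟨ov_eq_zero_of_disjoint (disjoint_map_inl_map_inr a b),
        ov_eq_zero_of_disjoint (disjoint_map_inl_map_inr a b).symm⟩
    rcases hstep.exists_of_union (disjoint_image_inl_image_inr hB.nil_notMem) hcross hov
      with ⟨C, hC, rfl⟩ | ⟨C, hC, rfl⟩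
    · obtain ⟨A₁, hA₁, rfl⟩ := hC.exists_of_image Sum.inl_injective
      obtain ⟨A', B', hAA', hBB', h⟩ := ih (hA.greedyStep hA₁) hB rfl
      exact ⟨A', B', .head hA₁ hAA', hBB', h⟩
    · obtain ⟨B₁, hB₁, rfl⟩ := hC.exists_of_image Sum.inr_injective
      obtain ⟨A', B', hAA', hBB', h⟩ := ih hA (hB.greedyStep hB₁) rfl
      exact ⟨A', B', hAA', .head hB₁ hBB', h⟩

theorem IsProper.barredUnion_ne_singleton (hA : IsProper A) (hB : IsProper B)
    (w : List (α ⊕ α)) : barredUnion A B ≠ {w} := by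
  obtain ⟨a, ha⟩ := hA.nonempty
  obtain ⟨b, hb⟩ := hB.nonempty
  intro h
  have hab : a.map Sum.inl = b.map Sum.inr :=
    (Finset.mem_singleton.1 (h ▸ mem_barredUnion.2 (.inl ⟨a, ha, rfl⟩))).trans
      (Finset.mem_singleton.1 (h ▸ mem_barredUnion.2 (.inr ⟨b, hb, rfl⟩))).symm
  exact Finset.disjoint_left.1 (disjoint_image_inl_image_inr hB.nil_notMem)
    (Finset.mem_image_of_mem _ ha) (hab ▸ Finset.mem_image_of_mem (List.map Sum.inr) hb)

theorem IsGreedyCircular.exists_isConcatenation {c : Cycle (α ⊕ α)} (hP : IsProper P)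
    (h : IsGreedyCircular (withBarred P) c) :
    ∃ A B w, Relation.ReflTransGen GreedyStep P A ∧ Relation.ReflTransGen GreedyStep P B ∧
      NonOverlapping (barredUnion A B) ∧ IsConcatenation (barredUnion A B) w ∧ c = w := by
  obtain ⟨w, hw, rfl⟩ := h
  obtain ⟨A, B, hPA, hPB, hov, hw⟩ := exists_nonOverlapping_of_isGreedyLinear hP hP hw
  have hA := hP.reflTransGen hPA
  have hB := hP.reflTransGen hPB
  have hfree :=
    substringFree_barredUnion hA.substringFree hB.substringFree hA.nil_notMem hB.nil_notMem
  refine ⟨A, B, w, hPA, hPB, hov, isConcatenation_of_isGreedyLinear hfree hov hw, ?_⟩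
  rw [ov_self_eq_zero_of_isGreedyLinear hfree hov hw (hA.barredUnion_ne_singleton hB w),
    List.drop_zero]

theorem IsConcatenation.isGreedyLinear_unbarredPart (h : IsConcatenation (barredUnion A B) u)
    (hov : NonOverlapping (barredUnion A B)) (hA : IsProper A) (hB : [] ∉ B) :
    IsGreedyLinear A (unbarredPart u) :=
  (isConcatenation_unbarredPart hA.nil_notMem hB h).isGreedyLinear hA.substringFree
    ((hov.mono Finset.subset_union_left).of_image Sum.inl_injective) hA.nonempty

theorem IsConcatenation.isGreedyLinear_barredPart (h : IsConcatenation (barredUnion A B) u)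
    (hov : NonOverlapping (barredUnion A B)) (hB : IsProper B) :
    IsGreedyLinear B (barredPart u) :=
  (isConcatenation_barredPart hB.nil_notMem h).isGreedyLinear hB.substringFree
    ((hov.mono Finset.subset_union_right).of_image Sum.inr_injective) hB.nonempty

end Doubled

section Rotations

variable {β κ : Type} [LinearOrder κ] (key : List β → κ) {v w : List β}

/-- The string with the least key among `b` and the first `m` strings of the sequence
`c, c.rotate 1, c.rotate 2, …`. -/
def leastRotation : ℕ → List β → List β → List β
  | 0, _, b => b
  | m + 1, c, b => leastRotation m (c.rotate 1) (if key c < key b then c else b)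

/-- The rotation of `w` with the least key. If the key is injective, it depends on the circular
string `⟨w⟩` only. -/
def canonicalRotation (w : List β) : List β := leastRotation key w.length w w

theorem leastRotation_isRotated (m : ℕ) {c b : List β} (h : b ~r c) :
    leastRotation key m c b ~r c := by
  induction m generalizing c b with
  | zero => exact h
  | succ m ih =>
    have hc : c ~r c.rotate 1 := ⟨1, rfl⟩
    refine (ih ?_).trans hc.symm
    split_ifs
    · exact hc
    · exact h.trans hc

theorem key_leastRotation_le_right (m : ℕ) (c b : List β) :
    key (leastRotation key m c b) ≤ key b := by
  induction m generalizing c b with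
  | zero => exact le_rfl
  | succ m ih =>
    refine (ih _ _).trans ?_
    split_ifs with h
    · exact h.le
    · exact le_rfl

theorem key_leastRotation_le_rotate {m k : ℕ} (hk : k < m) (c b : List β) :
    key (leastRotation key m c b) ≤ key (c.rotate k) := by
  induction m generalizing c b k with
  | zero => omega
  | succ m ih =>
    cases k with
    | zero =>
      refine (key_leastRotation_le_right key m _ _).trans ?_
      rw [List.rotate_zero]
      split_ifs with h
      · exact le_rfl
      · exact not_lt.1 h
    | succ k =>
      rw [Nat.add_comm k, ← List.rotate_rotate]
      exact ih (Nat.lt_of_succ_lt_succ hk) _ _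

theorem canonicalRotation_isRotated (w : List β) : canonicalRotation key w ~r w :=
  leastRotation_isRotated key _ (.refl w)

theorem key_canonicalRotation_le (h : w ~r v) : key (canonicalRotation key w) ≤ key v := by
  obtain ⟨n, hn, rfl⟩ := List.isRotated_iff_mod.1 h
  rcases hn.lt_or_eq with hn | rfl
  · exact key_leastRotation_le_rotate key hn w w
  · rw [List.rotate_length]
    exact key_leastRotation_le_right key _ w w

theorem canonicalRotation_eq (hkey : key.Injective) (h : w ~r v) :
    canonicalRotation key w = canonicalRotation key v :=
  hkey <| le_antisymm
    (key_canonicalRotation_le key (h.trans (canonicalRotation_isRotated key v).symm))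
    (key_canonicalRotation_le key (h.symm.trans (canonicalRotation_isRotated key w).symm))

end Rotations

section RotationKey

variable {α : Type}

/-- The pattern of bars of a string over the doubled alphabet. -/
def barPattern (w : List (α ⊕ α)) : List Bool := w.map Sum.isRight

theorem true_notMem_of_not_cons_lt_concat {t : List Bool} (h : ¬ false :: t < t ++ [false]) :
    true ∉ t := by
  induction t with
  | nil => exact List.not_mem_nil
  | cons b t ih =>
    rw [List.cons_append, List.cons_lt_cons_iff, not_or, not_and] at h
    obtain rfl : b = false := le_bot_iff.1 (not_lt.1 h.1)
    simpa using ih (h.2 rfl)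

/-- A least pattern begins with a longest run of unbarred letters, so the last letter, which
precedes that run, is barred. -/
theorem startsBlock_of_barPattern_minimal {u : List (α ⊕ α)} {a b : α} (ha : Sum.inl a ∈ u)
    (hb : Sum.inr b ∈ u) (hmin : ∀ v, u ~r v → ¬ barPattern v < barPattern u) :
    StartsBlock u := by
  constructor
  · rcases u with _ | ⟨c | c, t⟩
    · simp at ha
    · exact ⟨c, rfl⟩
    · obtain ⟨p, q, h⟩ := List.append_of_mem ha
      have hnlt := hmin (.inl a :: q ++ p) (h ▸ List.isRotated_append)
      simp [barPattern, List.cons_lt_cons_iff] at hnlt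
  · rcases List.eq_nil_or_concat' u with rfl | ⟨t, c | c, rfl⟩
    · simp at ha
    · have hnlt := hmin (.inl c :: t) (List.isRotated_append (l' := [Sum.inl c]))
      have hbars := true_notMem_of_not_cons_lt_concat (t := barPattern t)
        (by simpa [barPattern] using hnlt)
      simp_all [barPattern]
    · exact ⟨c, by simp⟩

variable [Fintype α]

/-- A numbering of the doubled alphabet. -/
noncomputable def letterIndex : α ⊕ α → Fin (Fintype.card (α ⊕ α)) := Fintype.equivFin (α ⊕ α)

/-- Strings are compared by their patterns of bars first, so that the least rotation starts a
block; the letters themselves only serve to break ties. -/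
noncomputable def rotationKey (w : List (α ⊕ α)) :
    List Bool ×ₗ List (Fin (Fintype.card (α ⊕ α))) :=
  toLex (barPattern w, w.map letterIndex)

theorem rotationKey_injective : (rotationKey (α := α)).Injective := fun _ _ h =>
  List.map_injective_iff.2 (Fintype.equivFin (α ⊕ α)).injective
    (congrArg Prod.snd (toLex.injective h))

theorem startsBlock_canonicalRotation {w : List (α ⊕ α)} {a b : α} (ha : Sum.inl a ∈ w)
    (hb : Sum.inr b ∈ w) : StartsBlock (canonicalRotation rotationKey w) := by
  have hrot := canonicalRotation_isRotated rotationKey w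
  refine startsBlock_of_barPattern_minimal (hrot.mem_iff.2 ha) (hrot.mem_iff.2 hb)
    fun v hv => (?_ : barPattern _ ≤ barPattern v).not_gt
  exact Prod.Lex.monotone_fst _ _ (key_canonicalRotation_le rotationKey (hrot.symm.trans hv))

/-- The lexicographic comparison of two strings of the same length, by the values of `f` at their
letters. -/
def compareBy {β κ : Type} [Ord κ] (f : β → κ) : List β → List β → Ordering
  | x :: l, y :: m => (compare (f x) (f y)).then (compareBy f l m)
  | _, _ => .eq

theorem compareBy_eq_iff {β κ : Type} [LinearOrder κ] {f : β → κ} {l m : List β}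
    (h : l.length = m.length) :
    (compareBy f l m = .lt ↔ l.map f < m.map f) ∧
      (compareBy f l m = .eq ↔ l.map f = m.map f) := by
  induction l generalizing m with
  | nil => rw [List.length_eq_zero_iff.1 h.symm]; simp [compareBy]
  | cons x l ih =>
    rcases m with _ | ⟨y, m⟩
    · simp at h
    obtain ⟨hlt, heq⟩ := ih (Nat.succ_injective h)
    simp [compareBy, Ordering.then_eq_lt, Ordering.then_eq_eq, compare_lt_iff_lt,
      List.cons_lt_cons_iff, hlt, heq]

theorem compareBy_then_compareBy_eq_lt_iff {l m : List (α ⊕ α)} (h : l.length = m.length) :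
    (compareBy Sum.isRight l m).then (compareBy letterIndex l m) = .lt ↔
      rotationKey l < rotationKey m := by
  rw [Ordering.then_eq_lt, (compareBy_eq_iff h).1, (compareBy_eq_iff h).2, (compareBy_eq_iff h).1,
    rotationKey, rotationKey, Prod.Lex.toLex_lt_toLex]
  rfl

end RotationKey

section Superstrings

theorem flatten_replicate_append_comm {β : Type} (a b : List β) (n : ℕ) :
    b ++ (List.replicate n (a ++ b)).flatten ++ a = (List.replicate (n + 1) (b ++ a)).flatten := by
  induction n with
  | zero => simp
  | succ n ih =>
    rw [List.replicate_succ, List.flatten_cons, List.replicate_succ, List.flatten_cons, ← ih]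
    simp only [List.append_assoc]

theorem IsCircularSubstring.exists_infix {β : Type} {x u : List β}
    (h : IsCircularSubstring x (u : Cycle β)) :
    ∃ n : ℕ, x <:+: (List.replicate n u).flatten := by
  obtain ⟨w, hw, n, hn⟩ := h
  obtain ⟨k, hk, rfl⟩ := List.isRotated_iff_mod.1 (Cycle.coe_eq_coe.1 hw)
  refine ⟨n + 1, ?_⟩
  rw [List.rotate_eq_drop_append_take hk, ← flatten_replicate_append_comm,
    List.take_append_drop]
  exact hn.trans ⟨_, _, rfl⟩

/-- An occurrence across a seam between two copies of `u` would contain both end letters. -/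
theorem infix_of_infix_flatten_replicate {β : Type} {u x : List β} {a b : β}
    (ha : u.head? = some a) (hb : u.getLast? = some b) (hx : a ∈ x → b ∉ x) {n : ℕ}
    (h : x <:+: (List.replicate n u).flatten) : x <:+: u := by
  induction n with
  | zero => exact (List.infix_nil.1 h) ▸ List.nil_infix
  | succ n ih =>
    rw [List.replicate_succ, List.flatten_cons, List.infix_append_iff] at h
    rcases h with h | h | ⟨p, q, rfl, hp, hq⟩
    · exact h
    · exact ih h
    rcases List.eq_nil_or_concat' p with rfl | ⟨p, c, rfl⟩
    · exact ih hq.isInfix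
    rcases q with _ | ⟨d, q⟩
    · rw [List.append_nil]
      exact hp.isInfix
    obtain ⟨s, hs⟩ := hp
    obtain rfl : c = b := by simpa [← hs, ← List.append_assoc] using hb
    obtain ⟨t, ht⟩ := hq
    obtain rfl : d = a := by
      cases n <;> simpa [List.replicate_succ, ha] using congrArg List.head? ht
    exact absurd (by simp) (hx (by simp))

variable {α : Type} {P : Finset (List α)} {c : Cycle (α ⊕ α)} {u : List (α ⊕ α)} {x : List α}

theorem StartsBlock.infix_unbarredPart (hu : StartsBlock u)
    (h : IsCircularSubstring (x.map Sum.inl) (u : Cycle (α ⊕ α))) : x <:+: unbarredPart u := by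
  obtain ⟨⟨a, ha⟩, b, hb⟩ := hu
  obtain ⟨n, hn⟩ := h.exists_infix
  have hinfix := infix_of_infix_flatten_replicate ha hb (by simp) hn
  rw [← unbarredPart_map_inl x]
  exact hinfix.filterMap Sum.getLeft?

theorem StartsBlock.infix_barredPart (hu : StartsBlock u)
    (h : IsCircularSubstring (x.map Sum.inr) (u : Cycle (α ⊕ α))) : x <:+: barredPart u := by
  obtain ⟨⟨a, ha⟩, b, hb⟩ := hu
  obtain ⟨n, hn⟩ := h.exists_infix
  have hinfix := infix_of_infix_flatten_replicate ha hb (by simp) hn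
  rw [← barredPart_map_inr x]
  exact hinfix.filterMap Sum.getRight?

/-- The shorter one of the two parts of a string over the doubled alphabet. -/
def shorterPart (u : List (α ⊕ α)) : List α :=
  if (unbarredPart u).length ≤ (barredPart u).length then unbarredPart u else barredPart u

theorem shorterPart_of {p : List α → Prop} (hl : p (unbarredPart u)) (hr : p (barredPart u)) :
    p (shorterPart u) := by
  rw [shorterPart]
  split_ifs
  exacts [hl, hr]

theorem two_mul_length_shorterPart_le (u : List (α ⊕ α)) :
    2 * (shorterPart u).length ≤ u.length := by
  have hsum := length_unbarredPart_add_length_barredPart u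
  rw [shorterPart]
  split_ifs <;> omega

/-- The back transformation `g` of the reduction: the shorter part of the canonical rotation of
a circular string. -/
noncomputable def halve [Fintype α] (c : Cycle (α ⊕ α)) : List α :=
  Quotient.liftOn c (fun w => shorterPart (canonicalRotation rotationKey w)) fun _ _ h =>
    congrArg shorterPart (canonicalRotation_eq rotationKey rotationKey_injective h)

theorem two_mul_length_halve_le [Fintype α] (c : Cycle (α ⊕ α)) :
    2 * (halve c).length ≤ c.length := by
  induction c using Quotient.inductionOn with
  | h w =>
    refine (two_mul_length_shorterPart_le _).trans_eq ?_
    exact (canonicalRotation_isRotated rotationKey w).perm.length_eq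

variable [DecidableEq α]

theorem IsCircularSubstring.subset {β : Type} {x u : List β}
    (h : IsCircularSubstring x (u : Cycle β)) : x ⊆ u := by
  obtain ⟨n, hn⟩ := h.exists_infix
  intro a ha
  obtain ⟨v, hv, hav⟩ := List.mem_flatten.1 (hn.subset ha)
  rwa [List.eq_of_mem_replicate hv] at hav

theorem map_inl_mem_withBarred (hx : x ∈ P) : x.map Sum.inl ∈ withBarred P :=
  Finset.mem_union_left _ (Finset.mem_image_of_mem _ hx)

theorem map_inr_mem_withBarred (hx : x ∈ P) : x.map Sum.inr ∈ withBarred P :=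
  Finset.mem_union_right _ (Finset.mem_image_of_mem _ hx)

theorem isLinearSuperstring_halve [Fintype α] (h : IsCircularSuperstring (withBarred P) c) :
    IsLinearSuperstring P (halve c) := by
  intro x hx
  rcases x.eq_nil_or_concat' with rfl | ⟨y, a, hxa⟩
  · exact List.nil_infix
  have ha : a ∈ x := by simp [hxa]
  induction c using Quotient.inductionOn with
  | h w =>
    have hinl := h _ (map_inl_mem_withBarred hx)
    have hinr := h _ (map_inr_mem_withBarred hx)
    have hblock := startsBlock_canonicalRotation (hinl.subset (List.mem_map_of_mem ha))
      (hinr.subset (List.mem_map_of_mem ha))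
    rw [← Quotient.sound (canonicalRotation_isRotated rotationKey w)] at hinl hinr
    exact shorterPart_of (hblock.infix_unbarredPart hinl) (hblock.infix_barredPart hinr)

theorem isCircularSuperstring_double {w : List α} (h : IsLinearSuperstring P w) :
    IsCircularSuperstring (withBarred P)
      ((w.map Sum.inl ++ w.map Sum.inr : List (α ⊕ α)) : Cycle (α ⊕ α)) := by
  intro x hx
  refine ⟨_, rfl, 1, ?_⟩
  rw [List.replicate_one, List.flatten_singleton]
  rcases mem_barredUnion.1 hx with ⟨a, ha, rfl⟩ | ⟨a, ha, rfl⟩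
  · exact ((h a ha).map Sum.inl).trans (List.prefix_append _ _).isInfix
  · exact ((h a ha).map Sum.inr).trans (List.suffix_append _ _).isInfix

theorem length_of_isShortest [Finite α] {w : List α} (hw : IsLinearSuperstring P w)
    (hwmin : ∀ z, IsLinearSuperstring P z → w.length ≤ z.length)
    (hc : IsCircularSuperstring (withBarred P) c)
    (hcmin : ∀ z, IsCircularSuperstring (withBarred P) z → c.length ≤ z.length) :
    c.length = 2 * w.length := by
  have := Fintype.ofFinite α
  have hle := hwmin _ (isLinearSuperstring_halve hc)
  have hhalve := two_mul_length_halve_le c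
  have hge := hcmin _ (isCircularSuperstring_double hw)
  rw [Cycle.length_coe, List.length_append, List.length_map, List.length_map] at hge
  omega

end Superstrings

section GreedySuperstrings

variable {α : Type} {P : Finset (List α)}

theorem isGreedyLinear_singleton_iff {β : Type} [DecidableEq β] {v w : List β} :
    IsGreedyLinear {v} w ↔ w = v := by
  refine ⟨fun h => ?_, fun h => h ▸ .refl⟩
  rcases Relation.ReflTransGen.cases_head h with h | ⟨_, ⟨x, hx, y, hy, hxy, -⟩, -⟩
  · exact (Finset.singleton_injective h).symm
  · exact absurd ((Finset.mem_singleton.1 hx).trans (Finset.mem_singleton.1 hy).symm) hxy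

theorem IsGreedyLinear.nonempty {β : Type} [DecidableEq β] {P : Finset (List β)} {w : List β}
    (h : IsGreedyLinear P w) : P.Nonempty := by
  rcases Relation.ReflTransGen.cases_head h with rfl | ⟨_, ⟨x, hx, -⟩, -⟩
  exacts [Finset.singleton_nonempty w, ⟨x, hx⟩]

theorem IsConcatenation.subset_of_mem {β : Type} {P : Finset (List β)} {w x : List β}
    (h : IsConcatenation P w) (hx : x ∈ P) : x ⊆ w := by
  obtain ⟨l, hl, rfl⟩ := h
  rw [← Finset.mem_val, ← hl] at hx
  exact (List.sublist_flatten_of_mem hx).subset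

theorem IsProper.exists_mem {β : Type} {P : Finset (List β)} (hP : IsProper P) :
    ∃ x ∈ P, ∃ a, a ∈ x := by
  obtain ⟨x, hx⟩ := hP.nonempty
  exact ⟨x, hx, List.exists_mem_of_ne_nil x fun h => hP.nil_notMem (h ▸ hx)⟩

variable [Fintype α] [DecidableEq α] {c : Cycle (α ⊕ α)}

theorem IsProper.isGreedyLinear_halve (hP : IsProper P) (hc : IsGreedyCircular (withBarred P) c) :
    IsGreedyLinear P (halve c) := by
  obtain ⟨A, B, w, hPA, hPB, hov, hw, rfl⟩ := hc.exists_isConcatenation hP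
  have hA := hP.reflTransGen hPA
  have hB := hP.reflTransGen hPB
  obtain ⟨x, hx, a, ha⟩ := hA.exists_mem
  obtain ⟨y, hy, b, hb⟩ := hB.exists_mem
  have hblock := startsBlock_canonicalRotation
    (hw.subset_of_mem (mem_barredUnion.2 (.inl ⟨x, hx, rfl⟩)) (List.mem_map_of_mem ha))
    (hw.subset_of_mem (mem_barredUnion.2 (.inr ⟨y, hy, rfl⟩)) (List.mem_map_of_mem hb))
  have hu := hw.of_isRotated_of_startsBlock (canonicalRotation_isRotated rotationKey w).symm hblock
  exact shorterPart_of (hPA.trans (hu.isGreedyLinear_unbarredPart hov hA hB.nil_notMem))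
    (hPB.trans (hu.isGreedyLinear_barredPart hov hB))

theorem isGreedyLinear_halve (hP : SubstringFree P) (hc : IsGreedyCircular (withBarred P) c) :
    IsGreedyLinear P (halve c) := by
  by_cases hnil : [] ∈ P
  · obtain rfl := hP.eq_singleton_nil hnil
    obtain ⟨w, hw, rfl⟩ := hc
    have hsingle : withBarred ({[]} : Finset (List α)) = {[]} := by simp [withBarred]
    rw [hsingle, isGreedyLinear_singleton_iff] at hw
    rw [hw, List.drop_nil]
    exact .refl
  · obtain ⟨w, hw, -⟩ := id hc
    have hne : P.Nonempty := by simpa [withBarred] using hw.nonempty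
    exact IsProper.isGreedyLinear_halve ⟨hP, hnil, hne⟩ hc

end GreedySuperstrings

section PerformanceRatio

variable {o c c' : ℤ}

theorem one_le_performanceRatio (o c : ℤ) : 1 ≤ performanceRatio o c := by
  rw [performanceRatio]
  split_ifs with heq hpos
  · exact le_rfl
  · have ho : (0 : ℝ) < o := Int.cast_pos.2 hpos.1
    have hc : (0 : ℝ) < c := Int.cast_pos.2 hpos.2
    rw [ENNReal.one_le_ofReal, le_max_iff, one_le_div hc, one_le_div ho]
    exact le_total _ _
  · exact le_top

theorem performanceRatio_mul_left {k : ℤ} (hk : 0 < k) (o c : ℤ) :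
    performanceRatio (k * o) (k * c) = performanceRatio o c := by
  have hk' : (k : ℝ) ≠ 0 := Int.cast_ne_zero.2 hk.ne'
  simp only [performanceRatio, mul_right_inj' hk.ne', mul_pos_iff_of_pos_left hk, Int.cast_mul,
    mul_div_mul_left _ _ hk']

theorem performanceRatio_le_of_le_of_le (hoc : o ≤ c) (hcc : c ≤ c') :
    performanceRatio o c ≤ performanceRatio o c' := by
  rcases hoc.eq_or_lt with rfl | hoc
  · rw [performanceRatio, if_pos rfl]
    exact one_le_performanceRatio _ _
  simp only [performanceRatio, hoc.ne', (hoc.trans_le hcc).ne', if_false]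
  by_cases ho : 0 < o
  · have hc := ho.trans hoc
    have ho' : (0 : ℝ) < o := Int.cast_pos.2 ho
    have hcc' : (c : ℝ) ≤ c' := Int.cast_le.2 hcc
    have hratio : (o : ℝ) / c ≤ c / o :=
      (div_le_one_of_le₀ (Int.cast_le.2 hoc.le) (Int.cast_pos.2 hc).le).trans
        ((one_le_div ho').2 (Int.cast_le.2 hoc.le))
    rw [if_pos ⟨ho, hc⟩, if_pos ⟨ho, hc.trans_le hcc⟩, max_eq_right hratio]
    exact ENNReal.ofReal_le_ofReal (le_max_of_le_right (by gcongr))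
  · simp [ho]

theorem performanceRatio_le_of_ge_of_ge (hoc : c ≤ o) (hcc : c' ≤ c) :
    performanceRatio o c ≤ performanceRatio o c' := by
  rcases hoc.eq_or_lt with rfl | hoc
  · rw [performanceRatio, if_pos rfl]
    exact one_le_performanceRatio _ _
  simp only [performanceRatio, hoc.ne, (hcc.trans_lt hoc).ne, if_false]
  by_cases hc' : 0 < c'
  · have hc := hc'.trans_le hcc
    have ho : (0 : ℝ) < o := Int.cast_pos.2 (hc.trans hoc)
    have _ : (0 : ℝ) < c' := Int.cast_pos.2 hc'
    have hccR : (c' : ℝ) ≤ c := Int.cast_le.2 hcc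
    have hratio : (c : ℝ) / o ≤ o / c :=
      (div_le_one_of_le₀ (Int.cast_le.2 hoc.le) ho.le).trans
        ((one_le_div (Int.cast_pos.2 hc)).2 (Int.cast_le.2 hoc.le))
    rw [if_pos ⟨hc.trans hoc, hc⟩, if_pos ⟨hc.trans hoc, hc'⟩, max_eq_left hratio]
    exact ENNReal.ofReal_le_ofReal (le_max_of_le_left (by gcongr))
  · simp [hc']

theorem performanceRatio_objectiveCost_le {β : Type} (m : Objective) (P : Finset (List β))
    {n k k' : ℕ} (hnk : n ≤ k) (hkk : k ≤ k') :
    performanceRatio (objectiveCost m P n) (objectiveCost m P k) ≤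
      performanceRatio (objectiveCost m P n) (objectiveCost m P k') := by
  cases m
  · exact performanceRatio_le_of_le_of_le (Int.ofNat_le.2 hnk) (Int.ofNat_le.2 hkk)
  · exact performanceRatio_le_of_ge_of_ge (sub_le_sub_left (Int.ofNat_le.2 hnk) _)
      (sub_le_sub_left (Int.ofNat_le.2 hkk) _)

theorem objectiveCost_better_iff {β : Type} (m : Objective) (P : Finset (List β)) {n k : ℕ} :
    (if m.isMax = true then objectiveCost m P k ≤ objectiveCost m P n
      else objectiveCost m P n ≤ objectiveCost m P k) ↔ n ≤ k := by
  cases m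
  · simp [Objective.isMax, objectiveCost]
  · simp only [Objective.isMax, objectiveCost, if_true]
    omega

theorem isOptimal_SLS_iff {β : Type} [DecidableEq β] (m : Objective) {P : Finset (List β)}
    {w : List β} : (SLS β m).IsOptimal P w ↔
      IsLinearSuperstring P w ∧ ∀ z, IsLinearSuperstring P z → w.length ≤ z.length :=
  and_congr .rfl (forall_congr' fun _ => imp_congr .rfl (objectiveCost_better_iff m P))

theorem isOptimal_SCS_iff {β : Type} [DecidableEq β] (m : Objective) {P : Finset (List β)}
    {c : Cycle β} : (SCS β m).IsOptimal P c ↔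
      IsCircularSuperstring P c ∧ ∀ z, IsCircularSuperstring P z → c.length ≤ z.length :=
  and_congr .rfl (forall_congr' fun _ => imp_congr .rfl (objectiveCost_better_iff m P))

variable {α : Type} [DecidableEq α]

theorem totalLength_withBarred (P : Finset (List α)) :
    totalLength (withBarred P) = 2 * totalLength P := by
  have hlength : ∀ f : α → α ⊕ α, f.Injective →
      ∑ w ∈ P.image (List.map f), w.length = totalLength P := fun f hf => by
    simp [totalLength, Finset.sum_image (List.map_injective_iff.2 hf).injOn]
  have hinter : ∑ w ∈ P.image (List.map (Sum.inl : α → α ⊕ α)) ∩ P.image (List.map Sum.inr),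
      w.length = 0 := by
    refine Finset.sum_eq_zero fun w hw => ?_
    simp only [Finset.mem_inter, Finset.mem_image] at hw
    obtain ⟨⟨x, -, rfl⟩, y, -, hyx⟩ := hw
    rw [eq_nil_of_infix_of_disjoint (hyx ▸ List.infix_rfl) (disjoint_map_inl_map_inr x y),
      List.length_nil]
  rw [totalLength, withBarred, ← add_zero (Finset.sum _ _), ← hinter, Finset.sum_union_inter,
    hlength _ Sum.inl_injective, hlength _ Sum.inr_injective, two_mul]

theorem objectiveCost_withBarred (m : Objective) (P : Finset (List α)) (n : ℕ) :
    objectiveCost m (withBarred P) (2 * n) = 2 * objectiveCost m P n := by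
  cases m <;> simp [objectiveCost, totalLength_withBarred, mul_sub]

variable {P : Finset (List α)} {w : List α} {c y : Cycle (α ⊕ α)}

theorem length_eq_two_mul_of_isOptimal [Finite α] (m : Objective) (hw : (SLS α m).IsOptimal P w)
    (hc : (SCS (α ⊕ α) m).IsOptimal (withBarred P) c) : c.length = 2 * w.length := by
  rw [isOptimal_SLS_iff] at hw
  rw [isOptimal_SCS_iff] at hc
  exact length_of_isShortest hw.1 hw.2 hc.1 hc.2

theorem performanceRatio_halve_le [Fintype α] (m : Objective)
    (hy : IsCircularSuperstring (withBarred P) y) (hw : (SLS α m).IsOptimal P w)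
    (hc : (SCS (α ⊕ α) m).IsOptimal (withBarred P) c) :
    performanceRatio (objectiveCost m P w.length) (objectiveCost m P (halve y).length) ≤
      performanceRatio (objectiveCost m (withBarred P) c.length)
        (objectiveCost m (withBarred P) y.length) := by
  have hle := ((isOptimal_SLS_iff m).1 hw).2 _ (isLinearSuperstring_halve hy)
  rw [← performanceRatio_mul_left two_pos, ← objectiveCost_withBarred, ← objectiveCost_withBarred,
    length_eq_two_mul_of_isOptimal m hw hc]
  exact performanceRatio_objectiveCost_le m _ (Nat.mul_le_mul_left 2 hle)
    (two_mul_length_halve_le y)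

end PerformanceRatio

section Machines

open Turing

variable {C : Type} {f : C → Option C} {m n : ℕ} {a b c : C}

/-- The machine with the transition function `f` gets from `a` to `b` in at most `n` steps. -/
def ReachesWithin (f : C → Option C) (n : ℕ) (a b : C) : Prop :=
  Nonempty (StateTransition.EvalsToInTime f a (some b) n)

theorem ReachesWithin.trans (h : ReachesWithin f m a b) (h' : ReachesWithin f n b c) :
    ReachesWithin f (m + n) a c :=
  Nat.add_comm n m ▸ ⟨h.some.trans f m n a b (some c) h'.some⟩

theorem ReachesWithin.of_step (h : f a = some b) : ReachesWithin f 1 a b :=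
  ⟨⟨⟨1, h⟩, le_rfl⟩⟩

theorem ReachesWithin.head (h : f a = some b) (h' : ReachesWithin f n b c) :
    ReachesWithin f (n + 1) a c :=
  Nat.add_comm 1 n ▸ (of_step h).trans h'

theorem ReachesWithin.mono (h : ReachesWithin f m a b) (hmn : m ≤ n) : ReachesWithin f n a b :=
  h.map fun e => ⟨e.toEvalsTo, e.steps_le_m.trans hmn⟩

/-- Splitting the configuration into its components lets `rfl` check a concrete step: the stacks,
a family, are compared one by one. -/
theorem step_eq {K Λ σ : Type} [DecidableEq K] {Γ : K → Type} {M : Λ → TM2.Stmt Γ Λ σ} {l : Λ}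
    {v v' : σ} {S S' : ∀ k, List (Γ k)} {l' : Option Λ} (hl : (TM2.stepAux (M l) v S).l = l')
    (hv : (TM2.stepAux (M l) v S).var = v') (hS : ∀ k, (TM2.stepAux (M l) v S).stk k = S' k) :
    TM2.step M ⟨some l, v, S⟩ = some ⟨l', v', S'⟩ := by
  subst hl hv
  rw [← funext hS]
  rfl

variable {X Y Γ Γ' : Type} {ρ σ : List Γ → X → Prop} {ρ' : List Γ' → Y → Prop} {h : X → Y}

theorem polyTimeComputable_of_reachesWithin (M : FinTM2) {ρ : List (M.Γ M.k₀) → X → Prop}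
    {ρ' : List (M.Γ M.k₁) → Y → Prop} (H : List (M.Γ M.k₀) → List (M.Γ M.k₁))
    (time : Polynomial ℕ)
    (hM : ∀ w, ReachesWithin M.step (time.eval w.length) (initList M w) (haltList M (H w)))
    (hH : ∀ w x, ρ w x → ρ' (H w) (h x)) : PolyTimeComputable ρ ρ' h := by
  have hout (w) : Nonempty (TM2OutputsInTime M (w.map (Equiv.refl (M.Γ M.k₀)).invFun)
      (some ((H w).map (Equiv.refl (M.Γ M.k₁)).invFun)) (time.eval w.length)) := by
    have hmap {T : Type} (l : List T) : l.map (Equiv.refl T).invFun = l := List.map_id l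
    rw [hmap, hmap]
    exact hM w
  exact ⟨fun w => H w.1, ⟨{
    tm := M
    inputAlphabet := .refl _
    outputAlphabet := .refl _
    time := time
    outputsFun := fun w => (hout w.1).some }⟩, fun w x hx => hH w.1 x hx⟩

theorem PolyTimeComputable.mono (hh : PolyTimeComputable ρ ρ' h) (hσρ : ∀ w x, σ w x → ρ w x) :
    PolyTimeComputable σ ρ' h := by
  obtain ⟨F, ⟨M⟩, hF⟩ := hh
  let incl (w : {w // ∃ x, σ w x}) : {w // ∃ x, ρ w x} := ⟨w.1, w.2.imp (hσρ w.1)⟩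
  exact ⟨F ∘ incl, ⟨{ M with outputsFun := fun w => M.outputsFun (incl w) }⟩,
    fun w x hx => hF (incl w) x (hσρ w.1 x hx)⟩

end Machines

theorem IsStrictReduction.restrict {A B : OptimizationProblem} {f : A.Inst → B.Inst}
    {g : B.Sol → A.Sol} (h : IsStrictReduction A B f g) {S : A.Inst → Prop} {T : B.Inst → Prop}
    (hST : ∀ x, S x → T (f x)) : IsStrictReduction (A.restrict S) (B.restrict T) f g where
  polyTime_f := h.polyTime_f.mono fun _ _ hx => ⟨hx.1, hx.2.1⟩
  polyTime_g := h.polyTime_g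
  instances x hx := ⟨h.instances x hx.1, hST x hx.2⟩
  solutions x hx := h.solutions x hx.1
  ratio x hx := h.ratio x hx.1

section Doubling

open Turing

variable {α : Type}

/-- The word without the codes of empty words, that is, without the end marks at its beginning (if
the flag is set) and behind other end marks. -/
def dropEmptyWords : Bool → List (Option α) → List (Option α)
  | _, [] => []
  | b, x :: l =>
    if (x.isNone && b) = true then dropEmptyWords b l else x :: dropEmptyWords x.isNone l

/-- The code of `withBarred P` that the doubling machine computes from one of `P`. The empty word
is its own barred copy, and must not be listed twice. -/
def doubleCode (w : List (Option α)) : List (Option (α ⊕ α)) :=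
  w.map (Option.map Sum.inl) ++ (dropEmptyWords true w).map (Option.map Sum.inr)

/-- The stacks of the doubling machine. -/
inductive DoubleStack
  | input
  | all
  | nonempty
  | output
  deriving DecidableEq

instance : Fintype DoubleStack where
  elems := {.input, .all, .nonempty, .output}
  complete x := by cases x <;> decide

/-- The labels of the doubling machine. -/
inductive DoubleLabel
  | scan
  | bar
  | copy
  deriving DecidableEq

instance : Fintype DoubleLabel where
  elems := {.scan, .bar, .copy}
  complete x := by cases x <;> decide

/-- The stack alphabets of the doubling machine. -/
def DoubleSymbol (α : Type) : DoubleStack → Type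
  | .output => Option (α ⊕ α)
  | _ => Option α

/-- The contents of the stacks of the doubling machine. -/
def doubleStk (input all nonempty : List (Option α)) (output : List (Option (α ⊕ α))) :
    ∀ k, List (DoubleSymbol α k)
  | .input => input
  | .all => all
  | .nonempty => nonempty
  | .output => output

/-- The states of the doubling machine: the symbol popped last, and whether a word begins. -/
abbrev DoubleState (α : Type) : Type := Option (Option α) × Bool

/-- The program of the doubling machine: `scan` reverses the input onto two stacks, on one of them
without empty words, and `bar` and `copy` move them to the output. -/
def doubleProgram : DoubleLabel → TM2.Stmt (DoubleSymbol α) DoubleLabel (DoubleState α)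
  | .scan =>
    .pop .input (fun s x => (x, s.2)) <|
    .branch (fun s => s.1.isSome)
      (.push .all (fun s => s.1.join) <|
        .branch (fun s => s.1.join.isNone && s.2) (.goto fun _ => .scan) <|
        .push .nonempty (fun s => s.1.join) <|
        .load (fun s => (s.1, s.1.join.isNone)) <| .goto fun _ => .scan)
      (.load (fun _ => (none, true)) <| .goto fun _ => .bar)
  | .bar =>
    .pop .nonempty (fun s x => (x, s.2)) <|
    .branch (fun s => s.1.isSome)
      (.push .output (fun s => s.1.join.map Sum.inr) <| .goto fun _ => .bar)
      (.load (fun _ => (none, true)) <| .goto fun _ => .copy)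
  | .copy =>
    .pop .all (fun s x => (x, s.2)) <|
    .branch (fun s => s.1.isSome)
      (.push .output (fun s => s.1.join.map Sum.inl) <| .goto fun _ => .copy)
      (.load (fun _ => (none, true)) .halt)

/-- The doubling machine, which computes `doubleCode`. -/
def doubleMachine (α : Type) [Fintype α] : FinTM2 where
  K := DoubleStack
  k₀ := .input
  k₁ := .output
  Γ := DoubleSymbol α
  Λ := DoubleLabel
  main := .scan
  σ := DoubleState α
  initialState := (none, true)
  Γk₀Fin := inferInstanceAs (Fintype (Option α))
  m := doubleProgram

theorem doubleMachine_scan (i a e : List (Option α)) (s : DoubleState α) :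
    ReachesWithin (TM2.step doubleProgram) (i.length + 1)
      ⟨some .scan, s, doubleStk i a e []⟩
      ⟨some .bar, (none, true),
        doubleStk [] (i.reverse ++ a) ((dropEmptyWords s.2 i).reverse ++ e) []⟩ := by
  induction i generalizing a e s with
  | nil => exact .of_step (step_eq rfl rfl (by intro k; cases k <;> rfl))
  | cons x i ih =>
    obtain ⟨y, b⟩ := s
    rw [dropEmptyWords]
    split_ifs with h
    · refine .head (b := ⟨some .scan, (some x, b), doubleStk i (x :: a) e []⟩) ?_
        (by simpa using ih (x :: a) e (some x, b))
      cases x <;> cases b <;> simp at h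
      exact step_eq rfl rfl (by intro k; cases k <;> rfl)
    · refine .head (b := ⟨some .scan, (some x, x.isNone), doubleStk i (x :: a) (x :: e) []⟩) ?_
        (by simpa using ih (x :: a) (x :: e) (some x, x.isNone))
      cases x <;> cases b <;> simp at h <;>
        exact step_eq rfl rfl (by intro k; cases k <;> rfl)

theorem doubleMachine_bar (a e : List (Option α)) (o : List (Option (α ⊕ α)))
    (s : DoubleState α) :
    ReachesWithin (TM2.step doubleProgram) (e.length + 1)
      ⟨some .bar, s, doubleStk [] a e o⟩
      ⟨some .copy, (none, true),
        doubleStk [] a [] ((e.map (Option.map Sum.inr)).reverse ++ o)⟩ := by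
  induction e generalizing o s with
  | nil => exact .of_step (step_eq rfl rfl (by intro k; cases k <;> rfl))
  | cons x e ih =>
    refine .head (b := ⟨some .bar, (some x, s.2), doubleStk [] a e (x.map Sum.inr :: o)⟩)
      (step_eq rfl rfl (by intro k; cases k <;> rfl)) ?_
    simpa using ih (x.map Sum.inr :: o) (some x, s.2)

theorem doubleMachine_copy (a : List (Option α)) (o : List (Option (α ⊕ α)))
    (s : DoubleState α) :
    ReachesWithin (TM2.step doubleProgram) (a.length + 1)
      ⟨some .copy, s, doubleStk [] a [] o⟩
      ⟨none, (none, true), doubleStk [] [] [] ((a.map (Option.map Sum.inl)).reverse ++ o)⟩ := by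
  induction a generalizing o s with
  | nil => exact .of_step (step_eq rfl rfl (by intro k; cases k <;> rfl))
  | cons x a ih =>
    refine .head (b := ⟨some .copy, (some x, s.2), doubleStk [] a [] (x.map Sum.inl :: o)⟩)
      (step_eq rfl rfl (by intro k; cases k <;> rfl)) ?_
    simpa using ih (x.map Sum.inl :: o) (some x, s.2)

theorem length_dropEmptyWords_le (b : Bool) (w : List (Option α)) :
    (dropEmptyWords b w).length ≤ w.length := by
  induction w generalizing b with
  | nil => exact le_rfl
  | cons x w ih =>
    rw [dropEmptyWords]
    split_ifs
    · exact (ih b).trans (Nat.le_succ _)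
    · exact Nat.succ_le_succ (ih _)

theorem initList_doubleMachine [Fintype α] (w : List (Option α)) :
    initList (doubleMachine α) w = ⟨some .scan, (none, true), doubleStk w [] [] []⟩ :=
  (TM2.Cfg.mk.injEq ..).mpr ⟨rfl, rfl, by funext k; cases k <;> rfl⟩

theorem haltList_doubleMachine [Fintype α] (w : List (Option (α ⊕ α))) :
    haltList (doubleMachine α) w = ⟨none, (none, true), doubleStk [] [] [] w⟩ :=
  (TM2.Cfg.mk.injEq ..).mpr ⟨rfl, rfl, by funext k; cases k <;> rfl⟩

theorem reachesWithin_doubleMachine [Fintype α] (w : List (Option α)) :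
    ReachesWithin (doubleMachine α).step (3 * w.length + 3)
      (initList (doubleMachine α) w) (haltList (doubleMachine α) (doubleCode w)) := by
  have hrun := (doubleMachine_scan w [] [] (none, true)).trans
    ((doubleMachine_bar _ _ [] _).trans (doubleMachine_copy _ _ _))
  simp only [List.append_nil, List.map_reverse, List.reverse_reverse, List.length_reverse] at hrun
  rw [initList_doubleMachine, haltList_doubleMachine]
  have hle := length_dropEmptyWords_le true w
  exact hrun.mono (by omega)

theorem dropEmptyWords_map_some_append {x : List α} (hx : x ≠ []) (b : Bool)
    (m : List (Option α)) :
    dropEmptyWords b (x.map some ++ m) = x.map some ++ dropEmptyWords false m := by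
  induction x generalizing b with
  | nil => exact absurd rfl hx
  | cons a x ih => rcases x with _ | ⟨c, x⟩ <;> simp_all [dropEmptyWords]

theorem dropEmptyWords_encodeWords (l : List (List α)) :
    dropEmptyWords true (encodeWords l) = encodeWords (l.filter (· ≠ [])) := by
  induction l with
  | nil => rfl
  | cons x l ih =>
    rw [encodeWords, List.flatMap_cons, ← encodeWords]
    by_cases hx : x = []
    · subst hx
      simpa [dropEmptyWords] using ih
    · rw [List.append_assoc, dropEmptyWords_map_some_append hx,
        List.filter_cons_of_pos (by simpa)]
      simpa [dropEmptyWords, encodeWords] using ih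

theorem map_encodeWords {β γ : Type} (f : β → γ) (l : List (List β)) :
    (encodeWords l).map (Option.map f) = encodeWords (l.map (List.map f)) := by
  simp [encodeWords, List.map_flatMap, List.flatMap_map, Function.comp_def]

variable [DecidableEq α]

theorem val_withBarred (P : Finset (List α)) :
    (withBarred P).val =
      P.val.map (List.map Sum.inl) + (P.val.filter (· ≠ [])).map (List.map Sum.inr) := by
  have hwithBarred : withBarred P = barredUnion P (P.filter (· ≠ [])) := by
    ext x
    simp only [withBarred, barredUnion, Finset.mem_union, Finset.mem_image, Finset.mem_filter]
    refine or_congr_right' fun hinl => exists_congr fun y => ?_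
    refine ⟨fun ⟨hy, hyx⟩ => ⟨⟨hy, ?_⟩, hyx⟩, fun ⟨⟨hy, _⟩, hyx⟩ => ⟨hy, hyx⟩⟩
    rintro rfl
    exact hinl ⟨[], hy, hyx⟩
  rw [hwithBarred, val_barredUnion (by simp), Finset.filter_val]

theorem codesSet_doubleCode {w : List (Option α)} {P : Finset (List α)} (h : CodesSet w P) :
    CodesSet (doubleCode w) (withBarred P) := by
  obtain ⟨l, hl, rfl⟩ := h
  refine ⟨l.map (List.map Sum.inl) ++ (l.filter (· ≠ [])).map (List.map Sum.inr), ?_, ?_⟩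
  · rw [val_withBarred, ← hl]
    simp
  · rw [doubleCode, dropEmptyWords_encodeWords, map_encodeWords, map_encodeWords, encodeWords,
      encodeWords, encodeWords, List.flatMap_append]

theorem polyTimeComputable_withBarred [Finite α] :
    PolyTimeComputable CodesSet CodesSet (withBarred (α := α)) := by
  have := Fintype.ofFinite α
  refine polyTimeComputable_of_reachesWithin (doubleMachine α) doubleCode
    (3 * Polynomial.X + 3) (fun w => ?_) (fun w P => codesSet_doubleCode)
  simp only [Polynomial.eval_add, Polynomial.eval_mul, Polynomial.eval_ofNat, Polynomial.eval_X]
  exact reachesWithin_doubleMachine w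

end Doubling

section Halving

open Turing

/-- The stacks of the halving machine. -/
inductive HalveStack
  | cur
  | best
  | curRev
  | bestRev
  | count
  | left
  | right
  | pairs
  | output
  deriving DecidableEq

instance : Fintype HalveStack where
  elems := {.cur, .best, .curRev, .bestRev, .count, .left, .right, .pairs, .output}
  complete x := by cases x <;> decide

/-- The labels of the halving machine. -/
inductive HalveLabel
  | start
  | test
  | compare
  | hold
  | restore
  | split
  | pair
  | emit
  deriving DecidableEq

instance : Fintype HalveLabel where
  elems := {.start, .test, .compare, .hold, .restore, .split, .pair, .emit}
  complete x := by cases x <;> decide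

variable {α : Type}

/-- The stack alphabets of the halving machine. -/
def HalveSymbol (α : Type) : HalveStack → Type
  | .cur | .best | .curRev | .bestRev => α ⊕ α
  | .count => Unit
  | .pairs => α × α
  | .left | .right | .output => α

/-- The contents of the stacks of the halving machine. -/
def halveStk (cur best curRev bestRev : List (α ⊕ α)) (count : List Unit) (left right : List α)
    (pairs : List (α × α)) (output : List α) : ∀ k, List (HalveSymbol α k)
  | .cur => cur
  | .best => best
  | .curRev => curRev
  | .bestRev => bestRev
  | .count => count
  | .left => left
  | .right => right
  | .pairs => pairs
  | .output => output

/-- The states of the halving machine: the letters popped last from two stacks, a letter kept for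
later, the results of comparing two strings by bars and by letters, and a flag. -/
@[ext] structure HalveState (α : Type) where
  /-- the letter popped last from the first one of two stacks -/
  fst : Option (α ⊕ α) := none
  /-- the letter popped last from the second one of two stacks -/
  snd : Option (α ⊕ α) := none
  /-- the first letter of the current rotation, which becomes the last one of the next -/
  held : Option (α ⊕ α) := none
  /-- the order of the current and the best rotation by bars, and by letters -/
  verdict : Ordering × Ordering := (.eq, .eq)
  /-- whether the loop goes on, or whether the left part is longer than the right one -/
  flag : Bool := false

noncomputable instance [Fintype α] : Fintype (HalveState α) :=
  Fintype.ofInjective (fun s => (s.fst, s.snd, s.held, s.verdict, s.flag)) fun s t h => by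
    simp only [Prod.mk.injEq] at h
    exact HalveState.ext h.1 h.2.1 h.2.2.1 h.2.2.2.1 h.2.2.2.2

/-- The orders of two strings of the same length by bars, and by letters. -/
noncomputable def comparison [Fintype α] (c b : List (α ⊕ α)) : Ordering × Ordering :=
  (compareBy Sum.isRight c b, compareBy letterIndex c b)

/-- The choice between two objects that belong to the strings of a comparison: the one of the first
string if that is less, otherwise the one of the second. -/
def lesserOf {T : Type} (v : Ordering × Ordering) (x y : T) : T :=
  if v.1.then v.2 = .lt then x else y

section Program

variable [Inhabited α]

/-- The letter in a register of the machine. -/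
def letterOf (x : Option (α ⊕ α)) : α ⊕ α := x.getD (.inl default)

/-- The letter in a register of the machine, without its bar. -/
def unbarredLetterOf (x : Option (α ⊕ α)) : α := Sum.elim id id (letterOf x)

/-- The letter that the machine writes for the best rotation: the one of the current rotation if
that has turned out less. -/
def HalveState.chosenLetter (s : HalveState α) : α ⊕ α :=
  letterOf (lesserOf s.verdict s.fst s.snd)

variable [Fintype α]

/-- The program of the halving machine. From `start` to `restore` it runs through all rotations of
its input, which it keeps, reversed between two rounds, on the stack `cur`, with the least rotation
so far on the stack `best`. From `split` on it extracts the shorter part of the latter: `pair`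
clips the longer part. -/
noncomputable def halveProgram :
    HalveLabel → TM2.Stmt (HalveSymbol α) HalveLabel (HalveState α)
  | .start =>
    .pop .cur (fun s x => { s with fst := x }) <|
    .branch (fun s => s.fst.isSome)
      (.push .curRev (fun s => letterOf s.fst) <|
        .push .bestRev (fun s => letterOf s.fst) <|
        .push .count (fun _ => ()) <| .goto fun _ => .start)
      (.load (fun _ => {}) <| .goto fun _ => .test)
  | .test =>
    .pop .count (fun s x => { s with flag := Option.isSome x }) <|
    .branch (fun s => s.flag)
      (.load (fun _ => {}) <| .goto fun _ => .compare)
      (.load (fun _ => {}) <| .goto fun _ => .split)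
  | .compare =>
    .pop .curRev (fun s x => { s with fst := x }) <|
    .branch (fun s => s.fst.isSome)
      (.pop .bestRev (fun s x => { s with snd := x }) <|
        .push .cur (fun s => letterOf s.fst) <|
        .push .best (fun s => letterOf s.snd) <|
        .load (fun s => { verdict :=
          ((compare (letterOf s.fst).isRight (letterOf s.snd).isRight).then s.verdict.1,
            (compare (letterIndex (letterOf s.fst)) (letterIndex (letterOf s.snd))).then
              s.verdict.2) }) <|
        .goto fun _ => .compare)
      (.load (fun s => { verdict := s.verdict }) <| .goto fun _ => .hold)
  | .hold =>
    .pop .cur (fun s x => { s with fst := x, held := x }) <|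
    .branch (fun s => s.fst.isSome)
      (.pop .best (fun s x => { s with snd := x }) <|
        .push .bestRev (fun s => s.chosenLetter) <| .goto fun _ => .restore)
      (.goto fun _ => .restore)
  | .restore =>
    .pop .cur (fun s x => { s with fst := x }) <|
    .branch (fun s => s.fst.isSome)
      (.pop .best (fun s x => { s with snd := x }) <|
        .push .bestRev (fun s => s.chosenLetter) <|
        .push .curRev (fun s => letterOf s.fst) <| .goto fun _ => .restore)
      (.branch (fun s => s.held.isSome)
        (.push .curRev (fun s => letterOf s.held) <|
          .load (fun _ => {}) <| .goto fun _ => .test)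
        (.load (fun _ => {}) <| .goto fun _ => .test))
  | .split =>
    .pop .bestRev (fun s x => { s with fst := x }) <|
    .branch (fun s => s.fst.isSome)
      (.pop .curRev (fun s _ => s) <|
        .branch (fun s => (letterOf s.fst).isLeft)
          (.push .left (fun s => unbarredLetterOf (α := α) s.fst) <| .goto fun _ => .split)
          (.push .right (fun s => unbarredLetterOf (α := α) s.fst) <| .goto fun _ => .split))
      (.load (fun _ => {}) <| .goto fun _ => .pair)
  | .pair =>
    .pop .left (fun s x => { s with fst := Option.map Sum.inl x }) <|
    .pop .right (fun s x => { s with snd := Option.map Sum.inl x }) <|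
    .branch (fun s => s.fst.isSome && s.snd.isSome)
      (.push .pairs (fun s =>
          (unbarredLetterOf (α := α) s.fst, unbarredLetterOf (α := α) s.snd)) <|
        .load (fun s => { flag := s.flag }) <| .goto fun _ => .pair)
      (.branch (fun s => s.fst.isSome || s.snd.isSome)
        (.load (fun s => { flag := s.flag || s.fst.isSome }) <| .goto fun _ => .pair)
        (.goto fun _ => .emit))
  | .emit =>
    .pop .pairs (fun s x => { s with
      fst := Option.map (fun p => Sum.inl (Prod.fst p)) x,
      snd := Option.map (fun p => Sum.inl (Prod.snd p)) x }) <|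
    .branch (fun s => s.fst.isSome)
      (.push .output (fun s => unbarredLetterOf (α := α) (if s.flag then s.snd else s.fst)) <|
        .load (fun s => { flag := s.flag }) <| .goto fun _ => .emit)
      (.load (fun _ => {}) .halt)

/-- The halving machine, which computes `halve`. -/
noncomputable def halveMachine (α : Type) [Fintype α] [Inhabited α] : FinTM2 where
  K := HalveStack
  k₀ := .cur
  k₁ := .output
  Γ := HalveSymbol α
  Λ := HalveLabel
  main := .start
  σ := HalveState α
  initialState := {}
  Γk₀Fin := inferInstanceAs (Fintype (α ⊕ α))
  m := halveProgram

theorem halveMachine_start (c c' b' : List (α ⊕ α)) (n : List Unit) (s : HalveState α) :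
    ReachesWithin (TM2.step halveProgram) (c.length + 1)
      ⟨some .start, s, halveStk c [] c' b' n [] [] [] []⟩
      ⟨some .test, {}, halveStk [] [] (c.reverse ++ c') (c.reverse ++ b')
        (List.replicate c.length () ++ n) [] [] [] []⟩ := by
  induction c generalizing c' b' n s with
  | nil => exact .of_step (step_eq rfl rfl (by intro k; cases k <;> rfl))
  | cons x c ih =>
    refine .head (b := ⟨some .start, { s with fst := some x },
      halveStk c [] (x :: c') (x :: b') (() :: n) [] [] [] []⟩)
      (step_eq rfl rfl (by intro k; cases k <;> rfl)) ?_
    have hc := ih (x :: c') (x :: b') (() :: n) { s with fst := some x }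
    rw [List.append_cons (List.replicate c.length ()), ← List.replicate_succ'] at hc
    simpa using hc

/-- The program pops the last letters first, so that the order of two letters takes precedence over
the verdict reached before. -/
theorem halveMachine_compare (c b c' b' : List (α ⊕ α)) (h : c'.length = b'.length)
    (n : List Unit) :
    ReachesWithin (TM2.step halveProgram) (c'.length + 1)
      ⟨some .compare, { verdict := comparison c b }, halveStk c b c' b' n [] [] [] []⟩
      ⟨some .hold, { verdict := comparison (c'.reverse ++ c) (b'.reverse ++ b) },
        halveStk (c'.reverse ++ c) (b'.reverse ++ b) [] [] n [] [] [] []⟩ := by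
  induction c' generalizing b' c b with
  | nil =>
    rw [List.length_eq_zero_iff.1 h.symm]
    exact .of_step (step_eq rfl rfl (by intro k; cases k <;> rfl))
  | cons x c' ih =>
    rcases b' with _ | ⟨y, b'⟩
    · simp at h
    refine .head (b := ⟨some .compare, { verdict := comparison (x :: c) (y :: b) },
      halveStk (x :: c) (y :: b) c' b' n [] [] [] []⟩)
      (step_eq rfl rfl (by intro k; cases k <;> rfl)) ?_
    simpa using ih (x :: c) (y :: b) b' (Nat.succ_injective h)

theorem halveMachine_restore (c b c' b' : List (α ⊕ α)) (h : c.length = b.length)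
    (n : List Unit) {s : HalveState α} {a : α ⊕ α} (hs : s.held = some a) :
    ReachesWithin (TM2.step halveProgram) (c.length + 1)
      ⟨some .restore, s, halveStk c b c' b' n [] [] [] []⟩
      ⟨some .test, {}, halveStk [] [] (a :: (c.reverse ++ c'))
        ((lesserOf s.verdict c b).reverse ++ b') n [] [] [] []⟩ := by
  obtain ⟨x₀, y₀, _, v, f⟩ := s
  subst hs
  induction c generalizing b c' b' x₀ y₀ with
  | nil =>
    rw [List.length_eq_zero_iff.1 h.symm, lesserOf, ite_self]
    exact .of_step (step_eq rfl rfl (by intro k; cases k <;> rfl))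
  | cons x c ih =>
    rcases b with _ | ⟨y, b⟩
    · simp at h
    refine .head (b := ⟨some .restore, ⟨some x, some y, some a, v, f⟩,
      halveStk c b (x :: c') (letterOf (lesserOf v (some x) (some y)) :: b') n [] [] [] []⟩)
      (step_eq rfl rfl (by intro k; cases k <;> rfl)) ?_
    have hc := ih b (x :: c') (letterOf (lesserOf v (some x) (some y)) :: b')
      (Nat.succ_injective h) (some x) (some y)
    unfold lesserOf at hc ⊢
    split_ifs at hc ⊢ <;> simpa [letterOf] using hc

theorem halveMachine_hold (c b : List (α ⊕ α)) (h : c.length = b.length) (n : List Unit)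
    (v : Ordering × Ordering) :
    ReachesWithin (TM2.step halveProgram) (c.length + 2)
      ⟨some .hold, { verdict := v }, halveStk c b [] [] n [] [] [] []⟩
      ⟨some .test, {},
        halveStk [] [] (c.rotate 1).reverse (lesserOf v c b).reverse n [] [] [] []⟩ := by
  rcases c with _ | ⟨x, c⟩
  · rw [List.length_eq_zero_iff.1 h.symm, lesserOf, ite_self]
    exact .head (b := ⟨some .restore, { verdict := v }, halveStk [] [] [] [] n [] [] [] []⟩)
      (step_eq rfl rfl (by intro k; cases k <;> rfl))
      (.of_step (step_eq rfl rfl (by intro k; cases k <;> rfl)))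
  rcases b with _ | ⟨y, b⟩
  · simp at h
  refine .head (b := ⟨some .restore, ⟨some x, some y, some x, v, false⟩,
    halveStk c b [] [letterOf (lesserOf v (some x) (some y))] n [] [] [] []⟩)
    (step_eq rfl rfl (by intro k; cases k <;> rfl)) ?_
  have hrestore := halveMachine_restore c b [] [letterOf (lesserOf v (some x) (some y))]
    (Nat.succ_injective h) n (s := ⟨some x, some y, some x, v, false⟩) rfl
  refine .mono ?_ (Nat.le_succ _)
  unfold lesserOf at hrestore ⊢
  split_ifs at hrestore ⊢ <;> simpa [letterOf] using hrestore

theorem halveMachine_search (m : ℕ) (c b : List (α ⊕ α)) (h : c.length = b.length) :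
    ReachesWithin (TM2.step halveProgram) (m * (2 * c.length + 4) + 1)
      ⟨some .test, {},
        halveStk [] [] c.reverse b.reverse (List.replicate m ()) [] [] [] []⟩
      ⟨some .split, {}, halveStk [] [] (c.rotate m).reverse
        (leastRotation rotationKey m c b).reverse [] [] [] [] []⟩ := by
  induction m generalizing c b with
  | zero =>
    rw [List.rotate_zero]
    exact .mono (.of_step (step_eq rfl rfl (by intro k; cases k <;> rfl))) (by omega)
  | succ m ih =>
    have hcompare := halveMachine_compare [] [] c.reverse b.reverse (by simpa) (.replicate m ())
    simp only [List.reverse_reverse, List.append_nil, List.length_reverse] at hcompare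
    have hhold := halveMachine_hold c b h (.replicate m ()) (comparison c b)
    have hlesser : lesserOf (comparison c b) c b =
        if rotationKey c < rotationKey b then c else b :=
      if_congr (compareBy_then_compareBy_eq_lt_iff h) rfl rfl
    have hlen : (c.rotate 1).length = (lesserOf (comparison c b) c b).length := by
      rw [List.length_rotate, hlesser]
      split_ifs
      exacts [rfl, h]
    have hsearch := ih (c.rotate 1) _ hlen
    rw [List.rotate_rotate, List.length_rotate, hlesser, Nat.add_comm 1] at hsearch
    rw [hlesser] at hhold
    refine .mono (.head (b := ⟨some .compare, { verdict := comparison [] [] },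
      halveStk [] [] c.reverse b.reverse (.replicate m ()) [] [] [] []⟩)
      (step_eq rfl rfl (by intro k; cases k <;> rfl)) (hcompare.trans (hhold.trans hsearch))) ?_
    rw [add_mul]
    omega

theorem halveMachine_split (c' b' : List (α ⊕ α)) (h : c'.length = b'.length) (l r : List α)
    (s : HalveState α) :
    ReachesWithin (TM2.step halveProgram) (b'.length + 1)
      ⟨some .split, s, halveStk [] [] c' b' [] l r [] []⟩
      ⟨some .pair, {}, halveStk [] [] [] [] [] (unbarredPart b'.reverse ++ l)
        (barredPart b'.reverse ++ r) [] []⟩ := by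
  induction b' generalizing c' l r s with
  | nil =>
    rw [List.length_eq_zero_iff.1 h]
    exact .of_step (step_eq rfl rfl (by intro k; cases k <;> rfl))
  | cons x b' ih =>
    rcases c' with _ | ⟨y, c'⟩
    · simp at h
    have hb := Nat.succ_injective h
    rcases x with a | a
    · refine .head (b := ⟨some .split, { s with fst := some (.inl a) },
        halveStk [] [] c' b' [] (a :: l) r [] []⟩)
        (step_eq rfl rfl (by intro k; cases k <;> rfl)) ?_
      simpa [unbarredPart, barredPart, List.filterMap_cons] using ih c' hb (a :: l) r _
    · refine .head (b := ⟨some .split, { s with fst := some (.inr a) },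
        halveStk [] [] c' b' [] l (a :: r) [] []⟩)
        (step_eq rfl rfl (by intro k; cases k <;> rfl)) ?_
      simpa [unbarredPart, barredPart, List.filterMap_cons] using ih c' hb l (a :: r) _

theorem halveMachine_pair {n : ℕ} {l r : List α} (hl : l.length ≤ n) (hr : r.length ≤ n)
    (p : List (α × α)) (f : Bool) :
    ReachesWithin (TM2.step halveProgram) (n + 1)
      ⟨some .pair, { flag := f }, halveStk [] [] [] [] [] l r p []⟩
      ⟨some .emit, { flag := f || decide (r.length < l.length) },
        halveStk [] [] [] [] [] [] [] ((l.zip r).reverse ++ p) []⟩ := by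
  induction n generalizing l r p f with
  | zero =>
    rw [List.length_eq_zero_iff.1 (Nat.le_zero.1 hl), List.length_eq_zero_iff.1 (Nat.le_zero.1 hr)]
    exact .of_step (step_eq rfl (by cases f <;> rfl) (by intro k; cases k <;> rfl))
  | succ n ih =>
    rcases l with _ | ⟨x, l⟩ <;> rcases r with _ | ⟨y, r⟩
    · exact .mono (.of_step (step_eq rfl (by cases f <;> rfl) (by intro k; cases k <;> rfl)))
        (Nat.le_add_left _ _)
    · refine .head (b := ⟨some .pair, { flag := f }, halveStk [] [] [] [] [] [] r p []⟩)
        (step_eq rfl (by cases f <;> rfl) (by intro k; cases k <;> rfl)) ?_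
      simpa using ih (l := []) (Nat.zero_le n) (Nat.le_of_succ_le_succ hr) p f
    · refine .head (b := ⟨some .pair, { flag := true }, halveStk [] [] [] [] [] l [] p []⟩)
        (step_eq rfl (by cases f <;> rfl) (by intro k; cases k <;> rfl)) ?_
      simpa using ih (r := []) (Nat.le_of_succ_le_succ hl) (Nat.zero_le n) p true
    · refine .head (b := ⟨some .pair, { flag := f }, halveStk [] [] [] [] [] l r ((x, y) :: p) []⟩)
        (step_eq rfl rfl (by intro k; cases k <;> rfl)) ?_
      simpa using ih (Nat.le_of_succ_le_succ hl) (Nat.le_of_succ_le_succ hr) ((x, y) :: p) f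

theorem halveMachine_emit (p : List (α × α)) (o : List α) (f : Bool) :
    ReachesWithin (TM2.step halveProgram) (p.length + 1)
      ⟨some .emit, { flag := f }, halveStk [] [] [] [] [] [] [] p o⟩
      ⟨none, {}, halveStk [] [] [] [] [] [] [] []
        ((p.map fun x => if f then x.2 else x.1).reverse ++ o)⟩ := by
  induction p generalizing o with
  | nil => exact .of_step (step_eq rfl rfl (by intro k; cases k <;> rfl))
  | cons x p ih =>
    refine .head (b := ⟨some .emit, { flag := f },
      halveStk [] [] [] [] [] [] [] p ((if f then x.2 else x.1) :: o)⟩)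
      (step_eq rfl rfl (by intro k; cases f <;> cases k <;> rfl)) ?_
    simpa using ih ((if f then x.2 else x.1) :: o)

theorem initList_halveMachine (w : List (α ⊕ α)) :
    initList (halveMachine α) w = ⟨some .start, {}, halveStk w [] [] [] [] [] [] [] []⟩ :=
  (TM2.Cfg.mk.injEq ..).mpr ⟨rfl, rfl, by funext k; cases k <;> rfl⟩

theorem haltList_halveMachine (w : List α) :
    haltList (halveMachine α) w = ⟨none, {}, halveStk [] [] [] [] [] [] [] [] w⟩ :=
  (TM2.Cfg.mk.injEq ..).mpr ⟨rfl, rfl, by funext k; cases k <;> rfl⟩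

end Program

theorem map_zip_eq_shorterPart (u : List (α ⊕ α)) :
    ((unbarredPart u).zip (barredPart u)).map
      (fun x => if decide ((barredPart u).length < (unbarredPart u).length) then x.2 else x.1) =
    shorterPart u := by
  rw [shorterPart]
  rcases le_or_gt (unbarredPart u).length (barredPart u).length with h | h
  · rw [if_pos h, decide_eq_false (not_lt.2 h)]
    exact List.map_fst_zip h
  · rw [if_neg (not_le.2 h), decide_eq_true h]
    exact List.map_snd_zip h.le

variable [Fintype α]

theorem reachesWithin_halveMachine_of_split [Inhabited α] (c u : List (α ⊕ α))
    (h : c.length = u.length) :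
    ReachesWithin (TM2.step halveProgram) (3 * u.length + 3)
      ⟨some .split, {}, halveStk [] [] c.reverse u.reverse [] [] [] [] []⟩
      ⟨none, {}, halveStk [] [] [] [] [] [] [] [] (shorterPart u)⟩ := by
  have hlength := length_unbarredPart_add_length_barredPart u
  have hsplit := halveMachine_split c.reverse u.reverse (by simpa) [] [] {}
  have hpair := halveMachine_pair (n := u.length) (l := unbarredPart u) (r := barredPart u)
    (by omega) (by omega) [] false
  have hemit := halveMachine_emit ((unbarredPart u).zip (barredPart u)).reverse []
    (decide ((barredPart u).length < (unbarredPart u).length))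
  rw [List.map_reverse, List.reverse_reverse, map_zip_eq_shorterPart] at hemit
  simp only [List.append_nil, List.reverse_reverse, List.length_reverse, Bool.false_or,
    List.length_zip] at hsplit hpair hemit
  exact (hsplit.trans (hpair.trans hemit)).mono (by omega)

theorem reachesWithin_halveMachine [Inhabited α] (w : List (α ⊕ α)) :
    ReachesWithin (halveMachine α).step (2 * w.length ^ 2 + 8 * w.length + 5)
      (initList (halveMachine α) w)
      (haltList (halveMachine α) (shorterPart (α := α) (canonicalRotation rotationKey w))) := by
  have hlength := (canonicalRotation_isRotated rotationKey w).perm.length_eq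
  have hstart := halveMachine_start w [] [] [] {}
  simp only [List.append_nil] at hstart
  have hsearch := halveMachine_search w.length w w rfl
  have hsplit := reachesWithin_halveMachine_of_split (w.rotate w.length)
    (canonicalRotation rotationKey w) (by rw [List.length_rotate, hlength])
  rw [initList_halveMachine, haltList_halveMachine]
  refine (hstart.trans (hsearch.trans hsplit)).mono ?_
  rw [hlength, show w.length * (2 * w.length + 4) = 2 * w.length ^ 2 + 4 * w.length by ring]
  omega

/-- A machine that halts at once, with two stacks, for input and output. -/
def haltMachine (Γ Γ' : Type) [Fintype Γ] : FinTM2 where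
  K := Bool
  k₀ := true
  k₁ := false
  Γ b := cond b Γ Γ'
  Λ := Unit
  main := ()
  σ := Unit
  initialState := ()
  Γk₀Fin := inferInstanceAs (Fintype Γ)
  m _ := .halt

theorem reachesWithin_haltMachine (Γ Γ' : Type) [Fintype Γ] :
    ReachesWithin (haltMachine Γ Γ').step 1 (initList (haltMachine Γ Γ') [])
      (haltList (haltMachine Γ Γ') []) :=
  .of_step (step_eq rfl rfl (by intro k; cases k <;> rfl))

theorem polyTimeComputable_halve :
    PolyTimeComputable CodesCircular CodesString (halve (α := α)) := by
  rcases isEmpty_or_nonempty α with hα | ⟨⟨a⟩⟩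
  · refine polyTimeComputable_of_reachesWithin (haltMachine (α ⊕ α) α) (fun _ => []) 1
      (fun w => ?_) fun _ _ _ => Subsingleton.elim (α := List α) _ _
    obtain rfl : w = [] := Subsingleton.elim (α := List (α ⊕ α)) _ _
    simpa using reachesWithin_haltMachine (α ⊕ α) α
  · have : Inhabited α := ⟨a⟩
    refine polyTimeComputable_of_reachesWithin (halveMachine α)
      (fun w => shorterPart (α := α) (canonicalRotation rotationKey w))
      (2 * Polynomial.X ^ 2 + 8 * Polynomial.X + 5) (fun w => ?_) (fun w c hc => ?_)
    · simp only [Polynomial.eval_add, Polynomial.eval_mul, Polynomial.eval_ofNat,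
        Polynomial.eval_X, Polynomial.eval_pow]
      exact reachesWithin_halveMachine w
    · subst hc
      rfl

end Halving

section Reductions

variable (α : Type) [Fintype α] [DecidableEq α] (m : Objective)

theorem isStrictReduction_halve : IsStrictReduction (SLS α m) (SCS (α ⊕ α) m) withBarred
    (halve (α := α)) where
  polyTime_f := polyTimeComputable_withBarred.mono fun _ _ h => h.1
  polyTime_g := polyTimeComputable_halve (α := α)
  instances _ _ := trivial
  solutions _ _ _ h := isLinearSuperstring_halve (α := α) h
  ratio _ _ _ hy _ hw _ hc := performanceRatio_halve_le m hy hw hc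

theorem isGreedyReduction_halve :
    IsGreedyReduction ((SLS α m).restrict SubstringFree)
      ((SCS (α ⊕ α) m).restrict SubstringFree) withBarred (halve (α := α)) :=
  { (isStrictReduction_halve α m).restrict fun _ => substringFree_withBarred with
    greedy := fun _ h _ hy => isGreedyLinear_halve h.2 hy }

end Reductions

end CircularSuperstring

theorem theorem1 (α : Type) [Fintype α] [DecidableEq α] :
    ∃ g : Cycle (α ⊕ α) → List α,
      (∀ m : Objective,
        IsStrictReduction (SLS α m) (SCS (α ⊕ α) m) withBarred g ∧
        IsGreedyReduction ((SLS α m).restrict SubstringFree)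
          ((SCS (α ⊕ α) m).restrict SubstringFree) withBarred g) ∧
      (∀ (P : Finset (List α)) (w : List α) (c : Cycle (α ⊕ α)),
        (SLS α .length).IsOptimal P w → (SCS (α ⊕ α) .length).IsOptimal (withBarred P) c →
          c.length = 2 * w.length) ∧
      (∀ (P : Finset (List α)) (c : Cycle (α ⊕ α)),
        IsCircularSuperstring (withBarred P) c → 2 * (g c).length ≤ c.length) :=
  ⟨halve, fun m => ⟨isStrictReduction_halve α m, isGreedyReduction_halve α m⟩,
    fun _ _ _ hw hc => length_eq_two_mul_of_isOptimal .length hw hc,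
    fun _ c _ => two_mul_length_halve_le c⟩
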